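/- **Definitions.** For a nonempty closed set $F\subset\mathbb R^2$ let $d_F(x)=\operatorname{dist}(x,F)$ be the Euclidean distance function and, for $r>0$, let $S_r(F)=\{x\in\mathbb R^2: d_F(x)=r\}$. Let $T_F$ (respectively $L_F$) be the set of all $r>0$ for which $S_r(F)$ is nonempty and is not a $1$-dimensional topological (respectively Lipschitz) manifold; here a metric space is a $1$-dimensional topological (Lipschitz) manifold if each of its points has an open neighbourhood that is homeomorphic (bilipschitz homeomorphic) to an open subset of $\mathbb R$. A point $a\in\mathbb R^2$ is a critical point of a locally Lipschitz function $f:\mathbb R^2\to\mathbb R$ if $0$ belongs to the Clarke subdifferential $$\partial f(a)=\{x^*\in(\mathbb R^2)^*: x^*(v)\le f^0(a,v)\ \text{for all } v\in\mathbb R^2\},\qquad f^0(a,v)=\limsup_{z\to a,\ t\to0+}\frac{f(z+tv)-f(z)}{t},$$ and $\operatorname{cv}(f)$ denotes the set of the values of $f$ at its critical points. A (possibly empty) compact set $B\subset\mathbb R$ is a $BT_{1/2}$ set if it has Lebesgue measure zero and $\sum_I |I|^{1/2}<\infty$, where $I$ runs over the bounded connected components of $\mathbb R\setminus B$ and $|I|$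 is the length of $I$. For a nonempty bounded set $B\subset\mathbb R$ and $\varepsilon>0$ put $B_\varepsilon=\{z\in\mathbb R:\operatorname{dist}(z,B)\le\varepsilon\}$, and let $\lambda$ be Lebesgue measure on $\mathbb R$. The set $B$ has zero $s$-dimensional Minkowski content if $\lim_{\varepsilon\to0+}\lambda(B_\varepsilon)/\varepsilon^{1-s}=0$. The upper Minkowski dimension $\overline{\dim}_M B$ is the infimum of all $t\ge0$ for which $B$ has zero $t$-dimensional Minkowski content (with $\overline{\dim}_M\emptyset=0$), and the packing dimension of $A\subset\mathbb R$ is $$\dim_P A=\inf\Big\{\sup_i\overline{\dim}_M A_i:\ A\subset\bigcup_{i=1}^\infty A_i,\ A_i\ \text{bounded}\Big\}.$$ **Theorem.** Let $A\subset(0,\infty)$. Then the following properties are equivalent. 1. $A\subset L_F$ for some nonempty closed set $F\subset\mathbb R^2$. 2. $A\subset\operatorname{cv}(d_F)$ for some nonempty closed set $F\subset\mathbb R^2$. 3. $A$ can be covered by countably many $BT_{1/2}$ sets. Moreover, for each nonempty closed set $F\subset\mathbb R^2$, each of the sets $\operatorname{cv}(d_F)$, $L_F$ and $T_F$ is a countable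 union of nonempty bounded sets with zero $1/2$-dimensional Minkowski content (the empty union is allowed), and $\dim_P(\operatorname{cv}(d_F))\le 1/2$. -/

import Mathlib

open Set Filter Topology MeasureTheory
open scoped NNReal ENNReal

namespace DistCrit

noncomputable section

/-- The Euclidean plane `ℝ²`. -/
abbrev Plane : Type := EuclideanSpace ℝ (Fin 2)

section Clarke

variable {E : Type*} [NormedAddCommGroup E] [NormedSpace ℝ E]

/-- The Clarke derivative `f⁰(a, v) = limsup_{z → a, t → 0+} (f (z + t v) - f z) / t`.
The upper limit is taken in the extended reals; it is finite when `f` is locally Lipschitz. -/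
def clarkeDeriv (f : E → ℝ) (a v : E) : EReal :=
  limsup (fun p : E × ℝ => (((f (p.1 + p.2 • v) - f p.1) / p.2 : ℝ) : EReal))
    (𝓝 a ×ˢ 𝓝[>] (0 : ℝ))

/-- The Clarke subdifferential `∂f(a)`, a set of continuous linear functionals. -/
def clarkeSubdiff (f : E → ℝ) (a : E) : Set (E →L[ℝ] ℝ) :=
  {φ | ∀ v : E, ((φ v : ℝ) : EReal) ≤ clarkeDeriv f a v}

/-- The set `Crit f` of critical points of `f`. -/
def critPoints (f : E → ℝ) : Set E := {a | 0 ∈ clarkeSubdiff f a}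

/-- The set `cv f = f (Crit f)` of critical values of `f`. -/
def critValues (f : E → ℝ) : Set ℝ := f '' critPoints f

end Clarke

section Manifolds

/-- `X` is a `k`-dimensional topological manifold: each point has an open neighbourhood that is
homeomorphic to an open subset of `ℝᵏ`. -/
def IsTopManifold (k : ℕ) (X : Type*) [MetricSpace X] : Prop :=
  ∀ a : X, ∃ U : Set X, IsOpen U ∧ a ∈ U ∧
    ∃ V : Set (EuclideanSpace ℝ (Fin k)), IsOpen V ∧ Nonempty (U ≃ₜ V)

/-- `X` is a `k`-dimensional Lipschitz manifold: each point has an open neighbourhood that is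
bilipschitz homeomorphic to an open subset of `ℝᵏ`. -/
def IsLipManifold (k : ℕ) (X : Type*) [MetricSpace X] : Prop :=
  ∀ a : X, ∃ U : Set X, IsOpen U ∧ a ∈ U ∧
    ∃ V : Set (EuclideanSpace ℝ (Fin k)), IsOpen V ∧
      ∃ φ : U ≃ V, (∃ K : ℝ≥0, LipschitzWith K φ) ∧ (∃ K : ℝ≥0, LipschitzWith K φ.symm)

end Manifolds

section DistanceFunction

/-- The distance function `d_F` of a (nonempty closed) planar set `F`. -/
def distFun (F : Set Plane) : Plane → ℝ := fun x => Metric.infDist x F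

/-- The distance sphere `S_r(F) = {x : d_F(x) = r}`. -/
def distSphere (F : Set Plane) (r : ℝ) : Set Plane := {x | distFun F x = r}

/-- `T_F`: all `r > 0` for which `S_r(F)` is nonempty and not a topological `1`-manifold. -/
def topExceptional (F : Set Plane) : Set ℝ :=
  {r | 0 < r ∧ (distSphere F r).Nonempty ∧ ¬ IsTopManifold 1 (distSphere F r)}

/-- `L_F`: all `r > 0` for which `S_r(F)` is nonempty and not a Lipschitz `1`-manifold. -/
def lipExceptional (F : Set Plane) : Set ℝ :=
  {r | 0 < r ∧ (distSphere F r).Nonempty ∧ ¬ IsLipManifold 1 (distSphere F r)}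

end DistanceFunction

section GapSums

/-- The gaps of `B ⊆ ℝ`: the bounded connected components of `ℝ \ B`. -/
def gaps (B : Set ℝ) : Set (Set ℝ) :=
  {I | (∃ x ∈ Bᶜ, I = connectedComponentIn Bᶜ x) ∧ Bornology.IsBounded I}

/-- The degree-`α` gap sum `G_α(B) = ∑ |I| ^ α` over all gaps `I` of `B`. -/
def gapSum (α : ℝ) (B : Set ℝ) : ℝ≥0∞ := ∑' I : gaps B, (volume (I : Set ℝ)) ^ α

/-- `BT_α` sets: (possibly empty) compact Lebesgue null sets with finite degree-`α` gap sum. -/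
def IsBT (α : ℝ) (B : Set ℝ) : Prop := IsCompact B ∧ volume B = 0 ∧ gapSum α B < ∞

end GapSums

section Minkowski

/-- The ratio `λ₁(A_ε) / ε ^ (1 - s)`, where `A_ε` is the closed `ε`-parallel set of `A ⊆ ℝ`. -/
def parallelRatio (s : ℝ) (A : Set ℝ) (ε : ℝ) : ℝ≥0∞ :=
  volume (Metric.cthickening ε A) / ENNReal.ofReal (ε ^ (1 - s))

/-- The lower `s`-dimensional Minkowski content of a (bounded) set `A ⊆ ℝ`. -/
def lowerMinkowskiContent (s : ℝ) (A : Set ℝ) : ℝ≥0∞ :=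
  liminf (parallelRatio s A) (𝓝[>] (0 : ℝ))

/-- The upper `s`-dimensional Minkowski content of a (bounded) set `A ⊆ ℝ`. -/
def upperMinkowskiContent (s : ℝ) (A : Set ℝ) : ℝ≥0∞ :=
  limsup (parallelRatio s A) (𝓝[>] (0 : ℝ))

/-- The `s`-dimensional Minkowski content of `A` exists and equals `c`. -/
def HasMinkowskiContent (s : ℝ) (A : Set ℝ) (c : ℝ≥0∞) : Prop :=
  lowerMinkowskiContent s A = c ∧ upperMinkowskiContent s A = c

/-- The upper Minkowski dimension of a bounded set `A ⊆ ℝ`,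
the infimum of all `t ≥ 0` for which the upper `t`-dimensional Minkowski content vanishes. -/
def upperMinkowskiDim (A : Set ℝ) : ℝ≥0∞ :=
  ⨅ (t : ℝ≥0) (_ : upperMinkowskiContent (t : ℝ) A = 0), (t : ℝ≥0∞)

/-- The packing dimension of `A ⊆ ℝ`: the infimum, over all countable covers of `A` by bounded
sets, of the supremum of the upper Minkowski dimensions of the members of the cover. -/
def packingDim (A : Set ℝ) : ℝ≥0∞ :=
  ⨅ (B : ℕ → Set ℝ) (_ : (∀ i, Bornology.IsBounded (B i)) ∧ A ⊆ ⋃ i, B i),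
    ⨆ i, upperMinkowskiDim (B i)

/-- `S` is the union of a countable (possibly empty) family of nonempty bounded sets with zero
`s`-dimensional Minkowski content. -/
def IsCountableUnionZeroContent (s : ℝ) (S : Set ℝ) : Prop :=
  ∃ 𝒮 : Set (Set ℝ), 𝒮.Countable ∧
    (∀ B ∈ 𝒮, B.Nonempty ∧ Bornology.IsBounded B ∧ HasMinkowskiContent s B 0) ∧ S = ⋃₀ 𝒮

end Minkowski

end

end DistCrit

namespace DistCrit

/-! ### Gaps of a closed subset of the line -/

/-! From cv to BT sets. At a critical point `a` with `d_F a > 0`, no open half-plane bounded by a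
line through `a` contains all nearest points, since otherwise `d_F` would decrease uniformly in some
direction (`exists_nearestPoint_of_mem_critPoints`). By compactness, either this holds with a
uniform margin `δ`, or `a` is the midpoint of two antipodal nearest points
(`mem_deepPoints_or_antipodal`). Points of the first kind are `2δ`-separated, hence countable. For
two nearby points `a`, `b` of the second kind, comparing each distance with the endpoints of the
other's diameter gives `|d_F(a)² - d_F(b)²| ≤ |a - b|²` and shows that `a - b` is nearly orthogonal
to the diameter. So one coordinate controls `|a - b|`, and `d_F` becomes a function `f` on a compact
set of reals with `|f x - f y| ≤ C (x - y)²` (`abs_sub_le_of_mem_midPoints`). The image of such an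
`f` is a `BT_{1/2}` set: its dimension is at most `1/2`, and adding its values in order of time
bounds the sum of root gaps by `√C` times the length of the time interval (`isBT_image`).

Lipschitz exceptional values are critical, because near a noncritical point the level set is a
Lipschitz graph (`isLipManifold_of_forall_notMem_critPoints`). The Minkowski and packing statements
follow from dominated convergence over the gaps (`IsBT.tendsto_parallelRatio`).

From BT sets to `L_F`. Finiteness of the sum of root gaps yields a continuous `φ` with `√(r' - r) ≤
φ r' - φ r` for `r < r'` in the set (`IsBT.exists_stretch`). Put sites at `(ψ r, ±r)` with `ψ` a
multiple of `φ`. The stretching keeps the other sites from coming nearer than `r` to `(ψ r, 0)`,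
where the `r`-sphere then has two branches at quadratic distance (`hasCusp_mirrorGraph`). Such a
cusp is incompatible with a bilipschitz chart (`HasCusp.not_isLipManifold`). Countably many of these
compact sets are placed far apart (`exists_closed_glue`). -/

theorem connectedComponentIn_compl_eq_Ioo {B : Set ℝ} {α β x : ℝ} (hα : α ∈ B) (hβ : β ∈ B)
    (hx : x ∈ Ioo α β) (h : Ioo α β ⊆ Bᶜ) : connectedComponentIn Bᶜ x = Ioo α β := by
  apply Subset.antisymm _ (isPreconnected_Ioo.subset_connectedComponentIn hx h)
  intro y hy
  have hc : OrdConnected (connectedComponentIn Bᶜ x) :=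
    isPreconnected_connectedComponentIn.ordConnected
  have hxm : x ∈ connectedComponentIn Bᶜ x := mem_connectedComponentIn (h hx)
  have hsub := connectedComponentIn_subset Bᶜ x
  constructor
  · by_contra! hle
    exact hsub (hc.out hy hxm ⟨hle, hx.1.le⟩) hα
  · by_contra! hle
    exact hsub (hc.out hxm hy ⟨hx.2.le, hle⟩) hβ

theorem exists_mem_Ioo_subset_compl {B : Set ℝ} (hB : IsClosed B) {x : ℝ} (hx : x ∉ B)
    (h₁ : (B ∩ Iic x).Nonempty) (h₂ : (B ∩ Ici x).Nonempty) :
    ∃ α ∈ B, ∃ β ∈ B, x ∈ Ioo α β ∧ Ioo α β ⊆ Bᶜ := by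
  have c₁ : IsClosed (B ∩ Iic x) := hB.inter isClosed_Iic
  have c₂ : IsClosed (B ∩ Ici x) := hB.inter isClosed_Ici
  have b₁ : BddAbove (B ∩ Iic x) := ⟨x, fun y hy => hy.2⟩
  have b₂ : BddBelow (B ∩ Ici x) := ⟨x, fun y hy => hy.2⟩
  have m₁ := c₁.csSup_mem h₁ b₁
  have m₂ := c₂.csInf_mem h₂ b₂
  have ne {y : ℝ} (hy : y ∈ B) : y ≠ x := fun h => hx (h ▸ hy)
  refine ⟨_, m₁.1, _, m₂.1, ⟨lt_of_le_of_ne m₁.2 (ne m₁.1),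
    lt_of_le_of_ne m₂.2 (ne m₂.1).symm⟩, ?_⟩
  intro y hy hyB
  rcases le_total y x with h | h
  · exact absurd (le_csSup b₁ ⟨hyB, h⟩) (not_le.2 hy.1)
  · exact absurd (csInf_le b₂ ⟨hyB, h⟩) (not_le.2 hy.2)

theorem Ioo_mem_gaps {B : Set ℝ} {α β : ℝ} (hα : α ∈ B) (hβ : β ∈ B) (hαβ : α < β)
    (h : Ioo α β ⊆ Bᶜ) : Ioo α β ∈ gaps B := by
  obtain ⟨x, hx⟩ := exists_between hαβ
  exact ⟨⟨x, h hx, (connectedComponentIn_compl_eq_Ioo hα hβ hx h).symm⟩, Metric.isBounded_Ioo _ _⟩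

theorem exists_eq_Ioo_of_mem_gaps {B : Set ℝ} (hB : IsClosed B) {I : Set ℝ} (hI : I ∈ gaps B) :
    ∃ α ∈ B, ∃ β ∈ B, α < β ∧ I = Ioo α β ∧ Ioo α β ⊆ Bᶜ := by
  obtain ⟨⟨x, hx, rfl⟩, hb⟩ := hI
  have h₁ : (B ∩ Iic x).Nonempty := by
    by_contra! h
    have : Iic x ⊆ connectedComponentIn Bᶜ x :=
      isPreconnected_Iic.subset_connectedComponentIn self_mem_Iic fun y hy hyB =>
        (h ▸ (⟨hyB, hy⟩ : y ∈ B ∩ Iic x) : y ∈ (∅ : Set ℝ))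
    exact not_bddBelow_Iic x (hb.bddBelow.mono this)
  have h₂ : (B ∩ Ici x).Nonempty := by
    by_contra! h
    have : Ici x ⊆ connectedComponentIn Bᶜ x :=
      isPreconnected_Ici.subset_connectedComponentIn self_mem_Ici fun y hy hyB =>
        (h ▸ (⟨hyB, hy⟩ : y ∈ B ∩ Ici x) : y ∈ (∅ : Set ℝ))
    exact not_bddAbove_Ici x (hb.bddAbove.mono this)
  obtain ⟨α, hα, β, hβ, hxI, hsub⟩ := exists_mem_Ioo_subset_compl hB hx h₁ h₂
  exact ⟨α, hα, β, hβ, hxI.1.trans hxI.2, connectedComponentIn_compl_eq_Ioo hα hβ hxI hsub, hsub⟩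

theorem gaps_pairwiseDisjoint {B : Set ℝ} : (gaps B).PairwiseDisjoint id := by
  rintro I ⟨⟨x, -, rfl⟩, -⟩ J ⟨⟨y, -, rfl⟩, -⟩ hne
  by_contra h
  obtain ⟨z, hz₁, hz₂⟩ := not_disjoint_iff.1 h
  exact hne ((connectedComponentIn_eq hz₁).trans (connectedComponentIn_eq hz₂).symm)

theorem gaps_countable {B : Set ℝ} (hB : IsClosed B) : (gaps B).Countable := by
  refine gaps_pairwiseDisjoint.countable_of_isOpen (fun I hI => ?_) fun I hI => ?_
  · obtain ⟨α, -, β, -, -, rfl, -⟩ := exists_eq_Ioo_of_mem_gaps hB hI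
    exact isOpen_Ioo
  · obtain ⟨α, -, β, -, h, rfl, -⟩ := exists_eq_Ioo_of_mem_gaps hB hI
    exact nonempty_Ioo.2 h

/-! ### Sums of square roots along sorted lists -/

/-- The sum of the square roots of the differences of consecutive entries of a list. -/
noncomputable def rootGapSum : List ℝ → ℝ
  | a :: b :: l => √(b - a) + rootGapSum (b :: l)
  | _ => 0

/-- A new entry splits at most one gap. The part lying on the side of `p` has length at most `|w -
p|`, and the other part is no longer than the gap that was split. Beyond an end of the list, the
only new gap has length at most `|w - p|`. -/
theorem rootGapSum_orderedInsert_le (w : ℝ) : ∀ l : List ℝ, l.Pairwise (· ≤ ·) → ∀ p ∈ l,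
    rootGapSum (l.orderedInsert (· ≤ ·) w) ≤ rootGapSum l + √|w - p|
  | [], _, p, hp => by simp at hp
  | [a], _, p, hp => by
    obtain rfl : p = a := by simpa using hp
    by_cases h : w ≤ p
    · simp only [List.orderedInsert, h, if_true, rootGapSum]
      rw [abs_of_nonpos (by linarith)]; simp
    · simp only [List.orderedInsert, h, if_false, rootGapSum]
      rw [abs_of_pos (by linarith)]; simp
  | a :: b :: l, hs, p, hp => by
    have hab : a ≤ b := List.rel_of_pairwise_cons hs (by simp)
    by_cases h : w ≤ a
    · have hap : a ≤ p := by
        rcases List.mem_cons.1 hp with rfl | hp'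
        · exact le_rfl
        · exact List.rel_of_pairwise_cons hs hp'
      have : √(a - w) ≤ √|w - p| := by
        apply Real.sqrt_le_sqrt
        rw [abs_of_nonpos (by linarith)]; linarith
      simp only [List.orderedInsert, h, if_true, rootGapSum]
      linarith
    push Not at h
    by_cases h' : w ≤ b
    · simp only [List.orderedInsert, not_le.2 h, h', if_true, if_false, rootGapSum]
      have e₁ : √(w - a) ≤ √(b - a) := Real.sqrt_le_sqrt (by linarith)
      have e₂ : √(b - w) ≤ √(b - a) := Real.sqrt_le_sqrt (by linarith)
      rcases List.mem_cons.1 hp with rfl | hp'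
      · have : √(w - p) ≤ √|w - p| := Real.sqrt_le_sqrt (le_abs_self _)
        linarith
      · have hbp : b ≤ p := by
          rcases List.mem_cons.1 hp' with rfl | hp''
          · exact le_rfl
          · exact List.rel_of_pairwise_cons hs.of_cons hp''
        have : √(b - w) ≤ √|w - p| := by
          apply Real.sqrt_le_sqrt
          rw [abs_of_nonpos (by linarith)]; linarith
        linarith
    · have key : ∀ q ∈ b :: l, rootGapSum (List.orderedInsert (· ≤ ·) w (a :: b :: l)) ≤
          rootGapSum (a :: b :: l) + √|w - q| := by
        intro q hq
        have ih := rootGapSum_orderedInsert_le w (b :: l) hs.of_cons q hq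
        simp only [List.orderedInsert, not_le.2 h, h', if_false, rootGapSum] at ih ⊢
        linarith
      rcases List.mem_cons.1 hp with rfl | hp'
      · refine (key b (by simp)).trans ?_
        push Not at h'
        have : √|w - b| ≤ √|w - p| := by
          apply Real.sqrt_le_sqrt
          rw [abs_of_pos (by linarith), abs_of_pos (by linarith)]; linarith
        linarith
      · exact key p hp'

/-- Pairwise different pairs of consecutive values of a sorted list contribute to `rootGapSum`. -/
theorem sum_sqrt_le_rootGapSum : ∀ l : List ℝ, l.Pairwise (· ≤ ·) → ∀ J : Finset (ℝ × ℝ),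
    (∀ p ∈ J, p.1 < p.2 ∧ p.1 ∈ l ∧ p.2 ∈ l ∧ ∀ x ∈ l, x ∉ Ioo p.1 p.2) →
    ∑ p ∈ J, √(p.2 - p.1) ≤ rootGapSum l
  | [], _, J, hJ => by
    rw [Finset.sum_eq_zero, rootGapSum]
    · simp
    · intro p hp; simpa using (hJ p hp).2.1
  | [a], _, J, hJ => by
    rw [Finset.sum_eq_zero, rootGapSum]
    · simp
    · intro p hp
      obtain ⟨h, h₁, h₂, -⟩ := hJ p hp
      simp at h₁ h₂
      linarith
  | a :: b :: l, hs, J, hJ => by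
    have hab : a ≤ b := List.rel_of_pairwise_cons hs (by simp)
    have hmin : ∀ x ∈ b :: l, b ≤ x := by
      intro x hx
      rcases List.mem_cons.1 hx with rfl | hx'
      · exact le_rfl
      · exact List.rel_of_pairwise_cons hs.of_cons hx'
    have fst_mem : ∀ p ∈ J, p ≠ (a, b) → p.1 ∈ b :: l := by
      intro p hp hne
      obtain ⟨h, h₁, h₂, h₃⟩ := hJ p hp
      rcases List.mem_cons.1 h₁ with h₁' | h₁'
      · rcases List.mem_cons.1 h₂ with h₂' | h₂'
        · linarith
        · by_cases hpb : a < b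
          · exfalso
            have : p.2 = b := by
              refine le_antisymm ?_ (hmin _ h₂')
              by_contra! hlt
              exact h₃ b (by simp) ⟨h₁' ▸ hpb, hlt⟩
            exact hne (Prod.ext h₁' this)
          · rw [h₁', le_antisymm hab (not_lt.1 hpb)]; simp
      · exact h₁'
    have ih := sum_sqrt_le_rootGapSum (b :: l) hs.of_cons (J.erase (a, b)) (by
      intro p hp
      obtain ⟨hne, hp⟩ := Finset.mem_erase.1 hp
      obtain ⟨h, h₁, h₂, h₃⟩ := hJ p hp
      have h₁' := fst_mem p hp hne
      refine ⟨h, h₁', ?_, fun x hx => h₃ x (List.mem_cons_of_mem _ hx)⟩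
      rcases List.mem_cons.1 h₂ with h₂' | h₂'
      · have := hmin _ h₁'
        linarith
      · exact h₂')
    rw [rootGapSum]
    by_cases hm : (a, b) ∈ J
    · rw [← Finset.add_sum_erase _ _ hm]
      exact add_le_add le_rfl ih
    · rw [Finset.erase_eq_of_notMem hm] at ih
      have := Real.sqrt_nonneg (b - a)
      linarith

/-- The values of a function that is Hölder with exponent `2` on a finite set of times. -/
theorem exists_sorted_rootGapSum_le {f : ℝ → ℝ} {W : Set ℝ} {C L : ℝ} (hC : 0 ≤ C)
    (hf : ∀ x ∈ W, ∀ y ∈ W, |f x - f y| ≤ C * (x - y) ^ 2) (hL : ∀ x ∈ W, -L ≤ x) (s : Finset ℝ) :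
    (s : Set ℝ) ⊆ W → ∃ l : List ℝ, l.Pairwise (· ≤ ·) ∧ (∀ x, x ∈ l ↔ ∃ t ∈ s, f t = x) ∧
      ∀ M, (∀ t ∈ s, t ≤ M) → -L ≤ M → rootGapSum l ≤ √C * (M + L) := by
  induction s using Finset.induction_on_max with
  | empty =>
    intro _
    refine ⟨[], List.Pairwise.nil, by simp, fun M _ hM => ?_⟩
    simp only [rootGapSum]
    exact mul_nonneg (Real.sqrt_nonneg _) (by linarith)
  | insert a s ha ih =>
    intro hsub
    rw [Finset.coe_insert, insert_subset_iff] at hsub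
    obtain ⟨l, hl, hmem, hsum⟩ := ih hsub.2
    refine ⟨l.orderedInsert (· ≤ ·) (f a), hl.orderedInsert _ _, ?_, ?_⟩
    · intro x
      rw [List.mem_orderedInsert, hmem]
      simp [eq_comm]
    · intro M hM hLM
      have haM := hM a (by simp)
      rcases s.eq_empty_or_nonempty with rfl | hne
      · obtain rfl : l = [] := by
          rw [List.eq_nil_iff_forall_not_mem]; intro x; simp [hmem]
        simp only [List.orderedInsert, rootGapSum]
        exact mul_nonneg (Real.sqrt_nonneg _) (by linarith)
      -- The new value is compared with the value at the last earlier time `m`, so that the costs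
      -- `√C * (a - m)` telescope.
      · set m := s.max' hne
        have hms : m ∈ s := s.max'_mem hne
        have hma : m < a := ha m hms
        have h₁ := hsum m (fun t ht => s.le_max' t ht) (hL m (hsub.2 hms))
        have h₂ := rootGapSum_orderedInsert_le (f a) l hl (f m) ((hmem _).2 ⟨m, hms, rfl⟩)
        have h₃ : √|f a - f m| ≤ √C * (a - m) := by
          rw [Real.sqrt_le_left (by nlinarith [Real.sqrt_nonneg C]), mul_pow, Real.sq_sqrt hC]
          exact hf a hsub.1 m (hsub.2 hms)
        nlinarith [Real.sqrt_nonneg C]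

/-- The endpoints of finitely many gaps are values of `f` at finitely many times, and no listed
value lies inside a gap. So the sorted list of these values bounds the partial sum by `2L√C`,
whatever the finite family. -/
theorem gapSum_image_lt_top {f : ℝ → ℝ} {W : Set ℝ} {C L : ℝ} (hC : 0 ≤ C)
    (hf : ∀ x ∈ W, ∀ y ∈ W, |f x - f y| ≤ C * (x - y) ^ 2) (hL : ∀ x ∈ W, |x| ≤ L)
    (hcl : IsClosed (f '' W)) : gapSum (1 / 2) (f '' W) < ∞ := by
  rcases W.eq_empty_or_nonempty with rfl | ⟨x₀, hx₀⟩
  · have : gaps (f '' ∅) = ∅ := by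
      rw [eq_empty_iff_forall_notMem]
      intro I hI
      obtain ⟨α, hα, -⟩ := exists_eq_Ioo_of_mem_gaps hcl hI
      simp at hα
    unfold gapSum
    rw [this]
    simp
  have hL0 : 0 ≤ L := (abs_nonneg _).trans (hL x₀ hx₀)
  refine lt_of_le_of_lt (b := ENNReal.ofReal (√C * (L + L))) ?_ ENNReal.ofReal_lt_top
  rw [gapSum, ENNReal.tsum_eq_iSup_sum]
  refine iSup_le fun T => ?_
  choose α hα β hβ hlt heq hdisj using
    fun I : gaps (f '' W) => exists_eq_Ioo_of_mem_gaps hcl I.2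
  choose s hs hsα using hα
  choose t ht htβ using hβ
  have hsum : ∑ I ∈ T, (volume (I : Set ℝ)) ^ (1 / 2 : ℝ) =
      ENNReal.ofReal (∑ I ∈ T, √(β I - α I)) := by
    rw [ENNReal.ofReal_sum_of_nonneg fun _ _ => Real.sqrt_nonneg _]
    refine Finset.sum_congr rfl fun I _ => ?_
    rw [heq I, Real.volume_Ioo, Real.sqrt_eq_rpow,
      ENNReal.ofReal_rpow_of_nonneg (by linarith [hlt I]) (by norm_num)]
  rw [hsum]
  apply ENNReal.ofReal_le_ofReal
  classical
  obtain ⟨l, hl, hmem, hle⟩ := exists_sorted_rootGapSum_le hC hf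
    (fun x hx => (abs_le.1 (hL x hx)).1) (T.image s ∪ T.image t) (by
      intro x hx
      simp only [Finset.coe_union, Finset.coe_image, mem_union, mem_image] at hx
      rcases hx with ⟨I, -, rfl⟩ | ⟨I, -, rfl⟩
      exacts [hs I, ht I])
  have hW : ∀ x ∈ T.image s ∪ T.image t, x ∈ W := by
    intro x hx
    simp only [Finset.mem_union, Finset.mem_image] at hx
    rcases hx with ⟨I, -, rfl⟩ | ⟨I, -, rfl⟩
    exacts [hs I, ht I]
  have h₁ := hle L (fun x hx => (abs_le.1 (hL x (hW x hx))).2) (by linarith)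
  refine le_trans ?_ h₁
  have hinj : Set.InjOn (fun I => (α I, β I)) T := by
    intro I _ J _ h
    simp only [Prod.mk.injEq] at h
    apply Subtype.ext
    rw [heq I, heq J, h.1, h.2]
  have h₂ : ∑ I ∈ T, √(β I - α I) = ∑ p ∈ T.image fun I => (α I, β I), √(p.2 - p.1) := by
    rw [Finset.sum_image hinj]
  rw [h₂]
  apply sum_sqrt_le_rootGapSum l hl
  intro p hp
  obtain ⟨I, hI, rfl⟩ := Finset.mem_image.1 hp
  refine ⟨hlt I, (hmem _).2 ⟨s I, ?_, hsα I⟩, (hmem _).2 ⟨t I, ?_, htβ I⟩, ?_⟩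
  · exact Finset.mem_union_left _ (Finset.mem_image_of_mem _ hI)
  · exact Finset.mem_union_right _ (Finset.mem_image_of_mem _ hI)
  · intro x hx hxI
    obtain ⟨y, hy, rfl⟩ := (hmem x).1 hx
    exact hdisj I hxI ⟨y, hW y hy, rfl⟩

/-- A map that is Hölder with exponent `2` halves the Hausdorff dimension, so the image has
dimension at most `1/2 < 1`. -/
theorem volume_image_eq_zero_of_sq {f : ℝ → ℝ} {W : Set ℝ} {C : ℝ} (hC : 0 ≤ C)
    (hf : ∀ x ∈ W, ∀ y ∈ W, |f x - f y| ≤ C * (x - y) ^ 2) : volume (f '' W) = 0 := by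
  have hH : HolderOnWith C.toNNReal 2 f W := by
    intro x hx y hy
    rw [edist_dist, edist_dist, Real.dist_eq, Real.dist_eq]
    calc ENNReal.ofReal |f x - f y| ≤ ENNReal.ofReal (C * |x - y| ^ 2) := by
          apply ENNReal.ofReal_le_ofReal
          rw [sq_abs]; exact hf x hx y hy
      _ = _ := by
          rw [ENNReal.ofReal_mul hC, ENNReal.ofReal_pow (abs_nonneg _)]
          norm_num [ENNReal.ofReal]
  have h₁ := hH.dimH_image_le (by norm_num)
  have h₂ : dimH W ≤ 1 := (dimH_mono (subset_univ W)).trans_eq Real.dimH_univ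
  have h₃ : dimH (f '' W) < ((1 : ℝ≥0) : ℝ≥0∞) := by
    refine lt_of_le_of_lt (h₁.trans (ENNReal.div_le_div_right h₂ _)) ?_
    simp only [ENNReal.coe_ofNat, one_div, ENNReal.coe_one]
    exact ENNReal.inv_lt_one.2 (by norm_num)
  have := hausdorffMeasure_of_dimH_lt h₃
  simpa [hausdorffMeasure_real] using this

/-- The inequality forces `g` to factor through `π` on `Q`, which reduces the claim to a function on
the compact set `π '' Q` of times. -/
theorem isBT_image {X : Type*} [TopologicalSpace X] {Q : Set X} (hQ : IsCompact Q)
    {π g : X → ℝ} (hπ : ContinuousOn π Q) (hg : ContinuousOn g Q) {C : ℝ} (hC : 0 ≤ C)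
    (h : ∀ a ∈ Q, ∀ b ∈ Q, |g a - g b| ≤ C * (π a - π b) ^ 2) : IsBT (1 / 2) (g '' Q) := by
  rcases Q.eq_empty_or_nonempty with rfl | ⟨a₀, _⟩
  · rw [image_empty, ← image_empty (id : ℝ → ℝ)]
    exact ⟨by simp, by simp, gapSum_image_lt_top (C := 0) (L := 0) le_rfl (by simp) (by simp)
      (by simp)⟩
  have : Nonempty X := ⟨a₀⟩
  have hinv : ∀ w ∈ π '' Q, Function.invFunOn π Q w ∈ Q ∧ π (Function.invFunOn π Q w) = w :=
    fun w hw => ⟨Function.invFunOn_mem hw, Function.invFunOn_eq hw⟩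
  set f : ℝ → ℝ := fun w => g (Function.invFunOn π Q w)
  have hf : ∀ x ∈ π '' Q, ∀ y ∈ π '' Q, |f x - f y| ≤ C * (x - y) ^ 2 := by
    intro x hx y hy
    have := h _ (hinv x hx).1 _ (hinv y hy).1
    rwa [(hinv x hx).2, (hinv y hy).2] at this
  have heq : g '' Q = f '' (π '' Q) := by
    rw [image_image]
    refine image_congr fun a ha => ?_
    have hm := mem_image_of_mem π ha
    have := h a ha _ (hinv _ hm).1
    rw [(hinv _ hm).2] at this
    simp only [sub_self, ne_eq, OfNat.ofNat_ne_zero, not_false_eq_true, zero_pow, mul_zero,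
      abs_nonpos_iff] at this
    exact sub_eq_zero.1 this
  have hcomp := hQ.image_of_continuousOn hg
  obtain ⟨L, hL⟩ := (hQ.image_of_continuousOn hπ).isBounded.exists_norm_le
  refine ⟨hcomp, ?_, ?_⟩
  · rw [heq]; exact volume_image_eq_zero_of_sq hC hf
  · have hcl := hcomp.isClosed
    rw [heq] at hcl ⊢
    exact gapSum_image_lt_top hC hf (fun x hx => hL x hx) hcl

/-! ### Minkowski content of `BT` sets -/

theorem IsBT.summable_sqrt {B : Set ℝ} (hB : IsBT (1 / 2) B) :
    Summable fun I : gaps B => √(volume (I : Set ℝ)).toReal := by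
  have h := ENNReal.summable_toReal hB.2.2.ne
  refine h.congr fun I => ?_
  rw [← ENNReal.toReal_rpow, Real.sqrt_eq_rpow]

/-- The parallel set consists of two outer margins of length `ε`, the null set `B`, and, in each
gap, points within `ε` of an endpoint. -/
theorem volume_cthickening_le {B : Set ℝ} (hB : IsCompact B) (hne : B.Nonempty)
    (h0 : volume B = 0) {ε : ℝ} (hε : 0 < ε) :
    volume (Metric.cthickening ε B) ≤ ENNReal.ofReal (2 * ε) +
      ∑' I : gaps B, ENNReal.ofReal (min (volume (I : Set ℝ)).toReal (2 * ε)) := by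
  have hm := hB.sInf_mem hne
  have hM := hB.sSup_mem hne
  have : Countable (gaps B) := (gaps_countable hB.isClosed).to_subtype
  have hsub : Metric.cthickening ε B ⊆ (Icc (sInf B - ε) (sInf B) ∪ Icc (sSup B) (sSup B + ε)) ∪ B ∪
      ⋃ I : gaps B, (I : Set ℝ) ∩ Metric.cthickening ε B := by
    intro x hx
    by_cases hxB : x ∈ B
    · exact Or.inl (Or.inr hxB)
    have hx' := hx
    rw [hB.cthickening_eq_biUnion_closedBall hε.le] at hx'
    simp only [mem_iUnion, Metric.mem_closedBall, Real.dist_eq, exists_prop] at hx'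
    obtain ⟨b, hb, hxb⟩ := hx'
    have hbm := csInf_le hB.bddBelow hb
    have hbM := le_csSup hB.bddAbove hb
    rw [abs_le] at hxb
    rcases le_total x (sInf B) with h | h
    · exact Or.inl (Or.inl (Or.inl ⟨by linarith, h⟩))
    rcases le_total (sSup B) x with h' | h'
    · exact Or.inl (Or.inl (Or.inr ⟨h', by linarith⟩))
    obtain ⟨α, hα, β, hβ, hxI, hI⟩ := exists_mem_Ioo_subset_compl hB.isClosed hxB
      ⟨_, hm, h⟩ ⟨_, hM, h'⟩
    exact Or.inr (mem_iUnion.2 ⟨⟨_, Ioo_mem_gaps hα hβ (hxI.1.trans hxI.2) hI⟩, hxI, hx⟩)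
  have hgap : ∀ I : gaps B, volume ((I : Set ℝ) ∩ Metric.cthickening ε B) ≤
      ENNReal.ofReal (min (volume (I : Set ℝ)).toReal (2 * ε)) := by
    rintro ⟨I, hI⟩
    obtain ⟨α, hα, β, hβ, hαβ, rfl, hdisj⟩ := exists_eq_Ioo_of_mem_gaps hB.isClosed hI
    rw [ENNReal.ofReal_min]
    refine le_min ?_ ?_
    · rw [ENNReal.ofReal_toReal (by simp)]
      exact measure_mono inter_subset_left
    · have : Ioo α β ∩ Metric.cthickening ε B ⊆ Icc α (α + ε) ∪ Icc (β - ε) β := by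
        rintro x ⟨hx, hx'⟩
        rw [hB.cthickening_eq_biUnion_closedBall hε.le] at hx'
        simp only [mem_iUnion, Metric.mem_closedBall, Real.dist_eq, exists_prop] at hx'
        obtain ⟨b, hb, hxb⟩ := hx'
        rw [abs_le] at hxb
        rcases le_or_gt b α with h | h
        · exact Or.inl ⟨hx.1.le, by linarith⟩
        · rcases le_or_gt β b with h' | h'
          · exact Or.inr ⟨by linarith, hx.2.le⟩
          · exact absurd hb (hdisj ⟨h, h'⟩)
      refine (measure_mono this).trans ((measure_union_le _ _).trans ?_)
      rw [Real.volume_Icc, Real.volume_Icc, ← ENNReal.ofReal_add (by linarith) (by linarith)]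
      apply ENNReal.ofReal_le_ofReal; linarith
  refine (measure_mono hsub).trans ((measure_union_le _ _).trans (add_le_add ?_ ?_))
  · refine (measure_union_le _ _).trans ?_
    rw [h0, add_zero]
    refine (measure_union_le _ _).trans ?_
    rw [Real.volume_Icc, Real.volume_Icc, ← ENNReal.ofReal_add (by linarith) (by linarith)]
    apply ENNReal.ofReal_le_ofReal; linarith
  · exact (measure_iUnion_le _).trans (ENNReal.tsum_le_tsum hgap)

/-- A minimum is at most a geometric mean. The bound does not depend on `ε` and is summable over the
gaps, so it serves as the dominating function. -/
theorem min_div_sqrt_le {l ε : ℝ} (hl : 0 ≤ l) (hε : 0 < ε) :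
    min l (2 * ε) / √ε ≤ 2 * √l := by
  have hs := Real.sqrt_pos.2 hε
  rw [div_le_iff₀ hs, mul_assoc, ← Real.sqrt_mul hl]
  rcases le_total l (2 * ε) with h | h
  · rw [min_eq_left h]
    have : l / 2 ≤ √(l * ε) := Real.le_sqrt_of_sq_le (by nlinarith)
    linarith
  · rw [min_eq_right h]
    have : ε ≤ √(l * ε) := Real.le_sqrt_of_sq_le (by nlinarith)
    linarith

theorem IsBT.tendsto_parallelRatio {B : Set ℝ} (hB : IsBT (1 / 2) B) :
    Tendsto (parallelRatio (1 / 2) B) (𝓝[>] (0 : ℝ)) (𝓝 0) := by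
  rcases B.eq_empty_or_nonempty with rfl | hne
  · have : parallelRatio (1 / 2) ∅ = fun _ => 0 := by
      funext ε; simp [parallelRatio]
    rw [this]; exact tendsto_const_nhds
  set len : gaps B → ℝ := fun I => (volume (I : Set ℝ)).toReal
  have hlen : ∀ I, 0 ≤ len I := fun I => ENNReal.toReal_nonneg
  set F : ℝ → ℝ := fun ε => 2 * √ε + ∑' I, min (len I) (2 * ε) / √ε
  have hsqrt : Tendsto (fun ε : ℝ => 2 * √ε) (𝓝[>] 0) (𝓝 0) := by
    have : Continuous fun ε : ℝ => 2 * √ε := by fun_prop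
    simpa using (this.tendsto 0).mono_left nhdsWithin_le_nhds
  have hF : Tendsto F (𝓝[>] 0) (𝓝 0) := by
    have h₂ : Tendsto (fun ε => ∑' I, min (len I) (2 * ε) / √ε) (𝓝[>] 0)
        (𝓝 (∑' _ : gaps B, (0 : ℝ))) := by
      apply tendsto_tsum_of_dominated_convergence (bound := fun I => 2 * √(len I))
        (hB.summable_sqrt.mul_left 2)
      · intro I
        refine squeeze_zero' ?_ ?_ hsqrt
        · filter_upwards [self_mem_nhdsWithin] with ε (hε : 0 < ε)
          exact div_nonneg (le_min (hlen I) (by linarith)) (Real.sqrt_nonneg _)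
        · filter_upwards [self_mem_nhdsWithin] with ε (hε : 0 < ε)
          rw [div_le_iff₀ (Real.sqrt_pos.2 hε), mul_assoc, Real.mul_self_sqrt hε.le]
          exact min_le_right _ _
      · filter_upwards [self_mem_nhdsWithin] with ε (hε : 0 < ε) I
        rw [Real.norm_of_nonneg
          (div_nonneg (le_min (hlen I) (by linarith)) (Real.sqrt_nonneg _))]
        exact min_div_sqrt_le (hlen I) hε
    simpa using hsqrt.add h₂
  have hG : Tendsto (fun ε => ENNReal.ofReal (F ε)) (𝓝[>] 0) (𝓝 0) := by
    simpa using ENNReal.tendsto_ofReal hF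
  refine tendsto_of_tendsto_of_tendsto_of_le_of_le' tendsto_const_nhds hG
    (Eventually.of_forall fun _ => zero_le) ?_
  filter_upwards [self_mem_nhdsWithin] with ε (hε : 0 < ε)
  have hs := Real.sqrt_pos.2 hε
  have hnn : ∀ I, 0 ≤ min (len I) (2 * ε) := fun I => le_min (hlen I) (by linarith)
  have hsummable : Summable fun I => min (len I) (2 * ε) / √ε :=
    (hB.summable_sqrt.mul_left 2).of_nonneg_of_le
      (fun I => div_nonneg (hnn I) hs.le) (fun I => min_div_sqrt_le (hlen I) hε)
  have hexp : ε ^ (1 - 1 / 2 : ℝ) = √ε := by rw [Real.sqrt_eq_rpow]; norm_num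
  rw [parallelRatio, hexp]
  refine ENNReal.div_le_of_le_mul ((volume_cthickening_le hB.1 hne hB.2.1 hε).trans_eq ?_)
  have hFnn : 0 ≤ ∑' I, min (len I) (2 * ε) / √ε :=
    tsum_nonneg fun I => div_nonneg (hnn I) hs.le
  rw [← ENNReal.ofReal_mul (add_nonneg (by positivity) hFnn), add_mul, mul_assoc,
    Real.mul_self_sqrt hε.le, ← tsum_mul_right,
    ENNReal.ofReal_add (by linarith) (tsum_nonneg fun I =>
      mul_nonneg (div_nonneg (hnn I) hs.le) hs.le),
    ENNReal.ofReal_tsum_of_nonneg (fun I => mul_nonneg (div_nonneg (hnn I) hs.le) hs.le)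
      (hsummable.mul_right _)]
  congr 2
  funext I
  rw [div_mul_cancel₀ _ hs.ne']

theorem hasMinkowskiContent_zero_of_subset {s : ℝ} {A B : Set ℝ} (hAB : A ⊆ B)
    (hB : Tendsto (parallelRatio s B) (𝓝[>] (0 : ℝ)) (𝓝 0)) : HasMinkowskiContent s A 0 := by
  have h : Tendsto (parallelRatio s A) (𝓝[>] (0 : ℝ)) (𝓝 0) :=
    tendsto_of_tendsto_of_tendsto_of_le_of_le tendsto_const_nhds hB (fun _ => zero_le)
      fun ε => ENNReal.div_le_div_right (measure_mono (Metric.cthickening_subset_of_subset ε hAB)) _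
  exact ⟨h.liminf_eq, h.limsup_eq⟩

/-! ### Countable covers by `BT` sets -/

theorem isCountableUnionZeroContent_of_subset {A : Set ℝ} {K : ℕ → Set ℝ}
    (hK : ∀ n, IsBT (1 / 2) (K n)) (hA : A ⊆ ⋃ n, K n) :
    IsCountableUnionZeroContent (1 / 2) A := by
  refine ⟨range (fun n => A ∩ K n) \ {∅}, (countable_range _).mono sdiff_subset, ?_, ?_⟩
  · rintro _ ⟨⟨n, rfl⟩, hne⟩
    exact ⟨nonempty_iff_ne_empty.2 hne, (hK n).1.isBounded.subset inter_subset_right,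
      hasMinkowskiContent_zero_of_subset inter_subset_right (hK n).tendsto_parallelRatio⟩
  · rw [sUnion_sdiff_singleton_empty, sUnion_range, ← inter_iUnion, inter_eq_left.2 hA]

theorem packingDim_le_of_subset {A : Set ℝ} {K : ℕ → Set ℝ}
    (hK : ∀ n, IsBT (1 / 2) (K n)) (hA : A ⊆ ⋃ n, K n) : packingDim A ≤ 1 / 2 := by
  refine iInf₂_le_of_le K ⟨fun i => (hK i).1.isBounded, hA⟩ (iSup_le fun i => ?_)
  refine iInf₂_le_of_le (1 / 2) ?_ (by simp)
  have := (hasMinkowskiContent_zero_of_subset Subset.rfl (hK i).tendsto_parallelRatio).2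
  simpa using this

theorem isBT_empty : IsBT (1 / 2) ∅ := by
  simpa using isBT_image (X := ℝ) (Q := ∅) isCompact_empty (π := id) (g := id) (C := 0)
    (by simp) (by simp) le_rfl (by simp)

theorem isBT_singleton (x : ℝ) : IsBT (1 / 2) {x} := by
  simpa using isBT_image (X := ℝ) (Q := {x}) isCompact_singleton (π := id) (g := id) (C := 0)
    (by simp) (by simp) le_rfl (by simp)

theorem exists_nat_cover_of_countable {S : Set (Set ℝ)} (hS : S.Countable)
    (h : ∀ B ∈ S, IsBT (1 / 2) B) {A : Set ℝ} (hA : A ⊆ ⋃₀ S) :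
    ∃ K : ℕ → Set ℝ, (∀ n, IsBT (1 / 2) (K n)) ∧ A ⊆ ⋃ n, K n := by
  obtain ⟨K, hK⟩ := (hS.insert ∅).exists_eq_range (insert_nonempty _ _)
  refine ⟨K, fun n => ?_, hA.trans ?_⟩
  · have : K n ∈ insert ∅ S := hK ▸ mem_range_self n
    rcases this with h' | h'
    · rw [h']; exact isBT_empty
    · exact h _ h'
  · rw [← sUnion_range, ← hK]
    exact sUnion_subset_sUnion (subset_insert _ _)

/-! ### Coordinates in the plane -/

theorem dist_sq_plane (x y : Plane) : dist x y ^ 2 = (x 0 - y 0) ^ 2 + (x 1 - y 1) ^ 2 := by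
  rw [EuclideanSpace.dist_eq, Real.sq_sqrt (by positivity), Fin.sum_univ_two, Real.dist_eq,
    Real.dist_eq, sq_abs, sq_abs]

theorem norm_sq_plane (x : Plane) : ‖x‖ ^ 2 = x 0 ^ 2 + x 1 ^ 2 := by
  simpa using dist_sq_plane x 0

theorem plane_ext {x y : Plane} (h₀ : x 0 = y 0) (h₁ : x 1 = y 1) : x = y := by
  ext i; fin_cases i <;> assumption

theorem distFun_nonneg (F : Set Plane) (x : Plane) : 0 ≤ distFun F x := Metric.infDist_nonneg

theorem distFun_le {F : Set Plane} {y : Plane} (hy : y ∈ F) (x : Plane) :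
    distFun F x ≤ dist x y := Metric.infDist_le_dist_of_mem hy

theorem distFun_sq_le {F : Set Plane} {y : Plane} (hy : y ∈ F) (x : Plane) :
    distFun F x ^ 2 ≤ (x 0 - y 0) ^ 2 + (x 1 - y 1) ^ 2 := by
  rw [← dist_sq_plane]
  exact pow_le_pow_left₀ (distFun_nonneg F x) (distFun_le hy x) 2

@[fun_prop]
theorem continuous_distFun (F : Set Plane) : Continuous (distFun F) :=
  Metric.continuous_infDist_pt F

theorem exists_distFun_eq {F : Set Plane} (hF : IsClosed F) (hne : F.Nonempty) (x : Plane) :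
    ∃ y ∈ F, dist x y = distFun F x :=
  let ⟨y, hy, h⟩ := hF.exists_infDist_eq_dist hne x
  ⟨y, hy, h.symm⟩

/-! ### Nearest points of critical points -/

/-- The set of the points of `F` nearest to `a`. -/
def nearestPoints (F : Set Plane) (a : Plane) : Set Plane := {y | y ∈ F ∧ dist a y = distFun F a}

theorem isCompact_nearestPoints {F : Set Plane} (hF : IsClosed F) (a : Plane) :
    IsCompact (nearestPoints F a) := by
  refine Metric.isCompact_of_isClosed_isBounded ?_ ?_
  · exact hF.inter (isClosed_eq (by fun_prop) continuous_const)
  · refine (Metric.isBounded_closedBall (x := a) (r := distFun F a)).subset ?_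
    intro y hy
    rw [Metric.mem_closedBall, dist_comm]; exact hy.2.le

/-- The scalar product of `y - a` and `v`. -/
def offsetDot (a v y : Plane) : ℝ := (y 0 - a 0) * v 0 + (y 1 - a 1) * v 1

/-- If all nearest points of `a` lay strictly on the side of `v`, then, by compactness, so would
those of all `z` near `a`, with a common margin. Moving `z` along `v` would then shorten its
distance at a fixed rate, making the Clarke derivative negative. -/
theorem exists_nearestPoint_of_mem_critPoints {F : Set Plane} (hF : IsClosed F) (hne : F.Nonempty)
    {a : Plane} (ha : 0 < distFun F a) (hc : a ∈ critPoints (distFun F)) (v : Plane) :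
    ∃ y ∈ nearestPoints F a, offsetDot a v y ≤ 0 := by
  by_contra! hpos
  obtain ⟨y₀, hy₀, hmin⟩ := (isCompact_nearestPoints hF a).exists_isMinOn
    (exists_distFun_eq hF hne a) (f := offsetDot a v) (by unfold offsetDot; fun_prop)
  set δ := offsetDot a v y₀ with hδ
  have hδ0 : 0 < δ := hpos y₀ hy₀
  -- The pairs violating half the margin form a compact set whose projection misses `a`; hence a
  -- neighbourhood of `a` is free of them.
  set P : Set (Plane × Plane) := {p | dist p.1 a ≤ 1 ∧ p.2 ∈ F ∧ dist p.1 p.2 = distFun F p.1 ∧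
    offsetDot p.1 v p.2 ≤ δ / 2}
  have hP : IsCompact P := by
    refine Metric.isCompact_of_isClosed_isBounded ?_ ?_
    · have hd : Continuous fun p : Plane × Plane => distFun F p.1 :=
        (continuous_distFun F).comp continuous_fst
      have c₁ : IsClosed {p : Plane × Plane | dist p.1 a ≤ 1} :=
        isClosed_le (by fun_prop) continuous_const
      have c₂ : IsClosed {p : Plane × Plane | dist p.1 p.2 = distFun F p.1} :=
        isClosed_eq (by fun_prop) hd
      have c₃ : IsClosed {p : Plane × Plane | offsetDot p.1 v p.2 ≤ δ / 2} :=
        isClosed_le (by unfold offsetDot; fun_prop) continuous_const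
      exact c₁.inter ((hF.preimage continuous_snd).inter (c₂.inter c₃))
    · refine ((Metric.isBounded_closedBall (x := a) (r := 1)).prod
        (Metric.isBounded_closedBall (x := a) (r := distFun F a + 2))).subset ?_
      rintro ⟨z, y⟩ ⟨h₁, h₂, h₃, h₄⟩
      refine ⟨h₁, ?_⟩
      simp only [Metric.mem_closedBall] at h₁ h₃ ⊢
      have h₅ : distFun F z ≤ distFun F a + dist z a := Metric.infDist_le_infDist_add_dist
      have h₆ := dist_triangle_left y a z
      linarith
  have hU : (Prod.fst '' P)ᶜ ∈ 𝓝 a := by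
    refine (hP.image continuous_fst).isClosed.isOpen_compl.mem_nhds ?_
    rintro ⟨⟨z, y⟩, ⟨h₁, h₂, h₃, h₄⟩, rfl⟩
    have := hmin (show y ∈ nearestPoints F z from ⟨h₂, h₃⟩)
    simp only [mem_ofPred_eq] at this h₄
    linarith
  set r := distFun F a
  have hU' : ∀ᶠ z in 𝓝 a, z ∈ (Prod.fst '' P)ᶜ ∧ dist z a < 1 ∧ distFun F z < 2 * r := by
    refine Filter.Eventually.and hU (Filter.Eventually.and (Metric.ball_mem_nhds a one_pos) ?_)
    exact (continuous_distFun F).continuousAt.eventually_lt continuousAt_const (by linarith)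
  have hT : ∀ᶠ t in 𝓝[>] (0 : ℝ), 0 < t ∧ t * (v 0 ^ 2 + v 1 ^ 2) < δ / 2 := by
    refine Filter.Eventually.and self_mem_nhdsWithin (nhdsWithin_le_nhds ?_)
    have : ContinuousAt (fun t : ℝ => t * (v 0 ^ 2 + v 1 ^ 2)) 0 := by fun_prop
    exact this.eventually_lt continuousAt_const (by simpa using hδ0)
  -- The squared distance drops by at least `t * (δ / 2)`, and the two distances add up to at most
  -- `4 * r`; the quotient gives the rate `δ / (8 * r)`.
  have hle : clarkeDeriv (distFun F) a v ≤ ((-(δ / (8 * r)) : ℝ) : EReal) := by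
    refine limsup_le_of_le (h := (hU'.prod_mk hT).mono ?_)
    rintro ⟨z, t⟩ ⟨⟨hz, hza, hzr⟩, ht, htv⟩
    simp only at hz hza hzr ht htv ⊢
    rw [EReal.coe_le_coe_iff]
    obtain ⟨y, hy, hzy⟩ := exists_distFun_eq hF hne z
    have hoff : δ / 2 < offsetDot z v y := by
      by_contra! h
      exact hz ⟨(z, y), ⟨hza.le, hy, hzy, h⟩, rfl⟩
    have h₁ := distFun_sq_le hy (z + t • v)
    have h₂ := dist_sq_plane z y
    rw [hzy] at h₂
    unfold offsetDot at hoff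
    simp only [PiLp.add_apply, PiLp.smul_apply, smul_eq_mul] at h₁
    set p := distFun F (z + t • v)
    set q := distFun F z
    have hp : 0 ≤ p := distFun_nonneg _ _
    have hq : 0 ≤ q := distFun_nonneg _ _
    have h₃ : p ^ 2 ≤ q ^ 2 - t * (δ / 2) := by
      nlinarith [mul_lt_mul_of_pos_left hoff ht, mul_lt_mul_of_pos_left htv ht]
    have hpq : p ≤ q := by
      have : 0 < t * (δ / 2) := by positivity
      exact abs_le_of_sq_le_sq' (by linarith) hq |>.2
    rw [div_le_iff₀ ht, neg_mul, div_mul_eq_mul_div, le_neg, div_le_iff₀ (by positivity)]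
    nlinarith [mul_nonneg (sub_nonneg.2 hpq) (show 0 ≤ 4 * r - (q + p) by linarith)]
  have h0 : ((0 : ℝ) : EReal) ≤ clarkeDeriv (distFun F) a v := by simpa using hc v
  have := EReal.coe_le_coe_iff.1 (h0.trans hle)
  have : 0 < δ / (8 * r) := by positivity
  linarith

/-- The points `a` for which every direction makes an angle with some nearest point that is
obtuse by a fixed amount. -/
def deepPoints (F : Set Plane) (δ : ℝ) : Set Plane :=
  {a | ∀ v : Plane, v 0 ^ 2 + v 1 ^ 2 = 1 → ∃ y ∈ nearestPoints F a, offsetDot a v y ≤ -δ}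

/-- Some nearest point of `a` lies on the side of `b` by at least `δ`, which bounds `d_F(b)²` by
`d_F(a)² + D² - 2δD` with `D = dist a b`. Adding the same bound with `a` and `b` exchanged leaves
`2δ ≤ D`. -/
theorem le_dist_of_mem_deepPoints {F : Set Plane} {δ : ℝ} {a b : Plane} (ha : a ∈ deepPoints F δ)
    (hb : b ∈ deepPoints F δ) (hne : a ≠ b) : 2 * δ ≤ dist a b := by
  have key : ∀ a b : Plane, a ∈ deepPoints F δ → a ≠ b →
      distFun F b ^ 2 ≤ distFun F a ^ 2 + dist a b ^ 2 - 2 * δ * dist a b := by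
    intro a b ha hne
    have hD : 0 < dist a b := dist_pos.2 hne
    obtain ⟨y, ⟨hy, hay⟩, hle⟩ := ha ((dist a b)⁻¹ • (a - b)) (by
      rw [← norm_sq_plane, norm_smul, ← dist_eq_norm, norm_inv, Real.norm_of_nonneg hD.le,
        inv_mul_cancel₀ hD.ne', one_pow])
    have h₁ := distFun_sq_le hy b
    have h₂ := dist_sq_plane a y
    rw [hay] at h₂
    have h₃ := dist_sq_plane a b
    have h₄ : (y 0 - a 0) * (a 0 - b 0) + (y 1 - a 1) * (a 1 - b 1) ≤ -δ * dist a b := by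
      have : offsetDot a ((dist a b)⁻¹ • (a - b)) y =
          ((y 0 - a 0) * (a 0 - b 0) + (y 1 - a 1) * (a 1 - b 1)) / dist a b := by
        simp only [offsetDot, PiLp.smul_apply, PiLp.sub_apply, smul_eq_mul]
        field_simp
      rwa [this, div_le_iff₀ hD] at hle
    nlinarith
  have h₁ := key a b ha hne
  have h₂ := key b a hb hne.symm
  rw [dist_comm b a] at h₂
  have hD : 0 < dist a b := dist_pos.2 hne
  nlinarith

theorem countable_deepPoints (F : Set Plane) {δ : ℝ} (hδ : 0 < δ) : (deepPoints F δ).Countable := by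
  refine PairwiseDisjoint.countable_of_isOpen (s := fun a => Metric.ball a δ) ?_
    (fun _ _ => Metric.isOpen_ball) fun a _ => ⟨a, Metric.mem_ball_self hδ⟩
  intro a ha b hb hne
  apply Metric.ball_disjoint_ball
  have := le_dist_of_mem_deepPoints ha hb hne
  linarith

/-- All nearest points lie in the closed half-plane of `v`. If none on its boundary line lay on the
side of `-n`, a slight tilt of `v` towards `n` would put all of them in an open half-plane, against
`H`. The nearest point so found is on that line at distance `distFun F a`. -/
theorem eq_sub_smul_of_nearestPoint {F : Set Plane} (hF : IsClosed F) {a v n : Plane}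
    (H : ∀ w, ∃ y ∈ nearestPoints F a, offsetDot a w y ≤ 0)
    (hv : ∀ y ∈ nearestPoints F a, 0 ≤ offsetDot a v y) (hv1 : v 0 ^ 2 + v 1 ^ 2 = 1)
    (hn1 : n 0 ^ 2 + n 1 ^ 2 = 1) (hvn : v 0 * n 0 + v 1 * n 1 = 0) :
    a - distFun F a • n ∈ F := by
  obtain ⟨y, hy, hyv, hyn⟩ :
      ∃ y ∈ nearestPoints F a, offsetDot a v y ≤ 0 ∧ offsetDot a n y ≤ 0 := by
    by_contra! hcon
    have hcn : Continuous (offsetDot a n) := by unfold offsetDot; fun_prop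
    have hcv : Continuous (offsetDot a v) := by unfold offsetDot; fun_prop
    have hS : IsCompact (nearestPoints F a ∩ {y | offsetDot a n y ≤ 0}) :=
      (isCompact_nearestPoints hF a).inter_right (isClosed_le hcn continuous_const)
    obtain ⟨y₁, hy₁, hy₁n⟩ := H n
    obtain ⟨y₀, hy₀, hmin⟩ := hS.exists_isMinOn ⟨y₁, hy₁, hy₁n⟩ hcv.continuousOn
    set m := offsetDot a v y₀
    have hm : 0 < m := by
      by_contra! h
      exact absurd hy₀.2 (not_le.2 (hcon y₀ hy₀.1 h))
    set r := distFun F a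
    have hr : 0 ≤ r := distFun_nonneg F a
    -- The tilt is small enough that its effect, at most `m / (r + 1) * r`, stays below `m`; the `+
    -- 1` covers `r = 0`.
    obtain ⟨y, hy, hyw⟩ := H (v + (m / (r + 1)) • n)
    have hexp : offsetDot a (v + (m / (r + 1)) • n) y =
        offsetDot a v y + m / (r + 1) * offsetDot a n y := by
      simp only [offsetDot, PiLp.add_apply, PiLp.smul_apply, smul_eq_mul]; ring
    rw [hexp] at hyw
    have hθ : 0 < m / (r + 1) := by positivity
    rcases le_or_gt (offsetDot a n y) 0 with h | h
    · have h₁ : m ≤ offsetDot a v y := hmin ⟨hy, h⟩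
      have h₂ : -r ≤ offsetDot a n y := by
        have h₃ := dist_sq_plane a y
        rw [hy.2] at h₃
        have : offsetDot a n y ^ 2 ≤ r ^ 2 := by
          unfold offsetDot
          nlinarith [sq_nonneg ((y 0 - a 0) * n 1 - (y 1 - a 1) * n 0)]
        exact (abs_le_of_sq_le_sq' this hr).1
      have h₃ : m / (r + 1) * r < m := by
        rw [div_mul_eq_mul_div, div_lt_iff₀ (by linarith)]; nlinarith
      nlinarith
    · have := hv y hy
      have := mul_pos hθ h
      linarith
  have hv0 := le_antisymm hyv (hv y hy)
  have h₃ := dist_sq_plane a y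
  rw [hy.2] at h₃
  have hr := distFun_nonneg F a
  set r := distFun F a
  unfold offsetDot at hv0 hyn
  obtain ⟨s, hs⟩ : ∃ s, s = (y 0 - a 0) * n 0 + (y 1 - a 1) * n 1 := ⟨_, rfl⟩
  have hdet : (v 0 * n 1 - v 1 * n 0) ^ 2 = 1 := by
    have : (v 0 * n 1 - v 1 * n 0) ^ 2 = (v 0 ^ 2 + v 1 ^ 2) * (n 0 ^ 2 + n 1 ^ 2)
      - (v 0 * n 0 + v 1 * n 1) ^ 2 := by ring
    rw [this, hv1, hn1, hvn]; norm_num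
  have hcross : ((y 0 - a 0) * n 1 - (y 1 - a 1) * n 0) = 0 := by
    have h₁ : ((y 0 - a 0) * n 1 - (y 1 - a 1) * n 0) * (v 0 * n 1 - v 1 * n 0) = 0 := by
      have : ((y 0 - a 0) * n 1 - (y 1 - a 1) * n 0) * (v 0 * n 1 - v 1 * n 0) =
        ((y 0 - a 0) * v 0 + (y 1 - a 1) * v 1) * (n 0 ^ 2 + n 1 ^ 2) -
        ((y 0 - a 0) * n 0 + (y 1 - a 1) * n 1) * (v 0 * n 0 + v 1 * n 1) := by ring
      rw [this, hv0, hvn]; ring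
    rcases mul_eq_zero.1 h₁ with h | h
    · exact h
    · rw [h] at hdet; norm_num at hdet
  have e₀ : y 0 - a 0 = s * n 0 := by
    have : y 0 - a 0 = (y 0 - a 0) * (n 0 ^ 2 + n 1 ^ 2) := by rw [hn1, mul_one]
    rw [this, hs]; linear_combination n 1 * hcross
  have e₁ : y 1 - a 1 = s * n 1 := by
    have : y 1 - a 1 = (y 1 - a 1) * (n 0 ^ 2 + n 1 ^ 2) := by rw [hn1, mul_one]
    rw [this, hs]; linear_combination -n 0 * hcross
  have hsr : s = -r := by
    have h₁ : s ^ 2 = r ^ 2 := by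
      rw [h₃, show a 0 - y 0 = -(s * n 0) by linarith, show a 1 - y 1 = -(s * n 1) by linarith]
      linear_combination -s ^ 2 * hn1
    rcases sq_eq_sq_iff_eq_or_eq_neg.1 h₁ with h | h
    · have : s ≤ 0 := hs ▸ hyn
      linarith
    · exact h
  have : y = a - r • n := by
    refine plane_ext ?_ ?_
    · simp only [PiLp.sub_apply, PiLp.smul_apply, smul_eq_mul]; rw [hsr] at e₀; linarith
    · simp only [PiLp.sub_apply, PiLp.smul_apply, smul_eq_mul]; rw [hsr] at e₁; linarith
  exact this ▸ hy.1

/-- A point with nearest points in all closed half-planes either is deep or is the midpoint of two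
nearest points. -/
theorem mem_deepPoints_or_antipodal {F : Set Plane} (hF : IsClosed F) {a : Plane}
    (H : ∀ w, ∃ y ∈ nearestPoints F a, offsetDot a w y ≤ 0) :
    (∃ n : ℕ, a ∈ deepPoints F (1 / (n + 1))) ∨
      ∃ u : Plane, u 0 ^ 2 + u 1 ^ 2 = 1 ∧ a + distFun F a • u ∈ F ∧ a - distFun F a • u ∈ F := by
  by_contra! hcon
  obtain ⟨hdeep, hanti⟩ := hcon
  -- Not being deep at any level gives unit directions with margins tending to `0`; a limit
  -- direction has all nearest points in its closed half-plane.
  have hseq : ∀ n : ℕ, ∃ v : Plane, v 0 ^ 2 + v 1 ^ 2 = 1 ∧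
      ∀ y ∈ nearestPoints F a, -(1 / ((n : ℝ) + 1)) < offsetDot a v y := by
    intro n
    have := hdeep n
    simp only [deepPoints, mem_ofPred_eq] at this
    push Not at this
    exact this
  choose V hV1 hV using hseq
  obtain ⟨v, -, φ, hφ, hlim⟩ := (isCompact_closedBall (0 : Plane) 1).tendsto_subseq (x := V) (by
    intro n
    rw [mem_closedBall_zero_iff]
    have := norm_sq_plane (V n)
    rw [hV1] at this
    nlinarith [norm_nonneg (V n)])
  have hv1 : v 0 ^ 2 + v 1 ^ 2 = 1 := by
    have hc : Continuous fun v : Plane => v 0 ^ 2 + v 1 ^ 2 := by fun_prop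
    refine tendsto_nhds_unique ((hc.tendsto v).comp hlim) ?_
    simp only [Function.comp_def, hV1]
    exact tendsto_const_nhds
  have hv : ∀ y ∈ nearestPoints F a, 0 ≤ offsetDot a v y := by
    intro y hy
    have hc : Continuous fun v : Plane => offsetDot a v y := by unfold offsetDot; fun_prop
    have h₁ : Tendsto (fun n => offsetDot a (V (φ n)) y + 1 / ((φ n : ℝ) + 1)) atTop
        (𝓝 (offsetDot a v y + 0)) :=
      ((hc.tendsto v).comp hlim).add
        (tendsto_one_div_add_atTop_nhds_zero_nat.comp hφ.tendsto_atTop)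
    rw [add_zero] at h₁
    refine ge_of_tendsto' h₁ fun n => ?_
    have := hV (φ n) y hy
    linarith
  set n : Plane := !₂[-v 1, v 0]
  have h₁ := eq_sub_smul_of_nearestPoint hF (n := n) H hv hv1 (by simp [n]; linarith)
    (by simp [n]; ring)
  have h₂ := eq_sub_smul_of_nearestPoint hF (n := -n) H hv hv1 (by simp [n]; linarith)
    (by simp [n]; ring)
  rw [smul_neg, sub_neg_eq_add] at h₂
  exact hanti n (by simp [n]; linarith) h₂ h₁

/-! ### Midpoints of antipodal nearest points -/

/-- The squared distances from `a` to the two endpoints of the diameter differ only in the sign of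
the cross term, and the smaller one is still at least `d_F(a)²`. -/
theorem antipodal_inequality {F : Set Plane} {a b u : Plane} (hu : u 0 ^ 2 + u 1 ^ 2 = 1)
    (h₁ : b + distFun F b • u ∈ F) (h₂ : b - distFun F b • u ∈ F) :
    distFun F a ^ 2 + 2 * distFun F b * |(b 0 - a 0) * u 0 + (b 1 - a 1) * u 1| ≤
      (b 0 - a 0) ^ 2 + (b 1 - a 1) ^ 2 + distFun F b ^ 2 := by
  have k₁ := distFun_sq_le h₁ a
  have k₂ := distFun_sq_le h₂ a
  simp only [PiLp.add_apply, PiLp.sub_apply, PiLp.smul_apply, smul_eq_mul] at k₁ k₂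
  set s := distFun F b
  have hs : s ^ 2 * (u 0 ^ 2 + u 1 ^ 2) = s ^ 2 := by rw [hu, mul_one]
  rcases abs_cases ((b 0 - a 0) * u 0 + (b 1 - a 1) * u 1) with ⟨h, -⟩ | ⟨h, -⟩ <;> rw [h] <;>
    nlinarith

/-- The vector `(p, q)` is short compared with `ρ`, so the hypothesis makes it nearly orthogonal to
`(α, β)`. As `α` dominates `β`, a large `p` has to be balanced by a comparable `q`. -/
theorem abs_le_two_mul_abs_of_nearly_orthogonal {p q α β ρ : ℝ} (hρ : 0 < ρ)
    (hN : p ^ 2 + q ^ 2 ≤ (ρ / 8) ^ 2) (hu : α ^ 2 + β ^ 2 = 1) (hαβ : |β| ≤ |α|)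
    (h : ρ * |p * α + q * β| ≤ p ^ 2 + q ^ 2) : |p| ≤ 2 * |q| := by
  have hp := abs_nonneg p
  have hq := abs_nonneg q
  have hα : 1 / 2 ≤ |α| := by
    have h₁ := sq_abs α
    have h₂ := sq_abs β
    nlinarith [abs_nonneg α, abs_nonneg β]
  have h₁ : p ^ 2 + q ^ 2 ≤ (|p| + |q|) * (ρ / 8) := by
    have hS : √(p ^ 2 + q ^ 2) ≤ ρ / 8 := (Real.sqrt_le_left (by positivity)).2 hN
    have hS' : √(p ^ 2 + q ^ 2) ≤ |p| + |q| := by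
      rw [Real.sqrt_le_left (by positivity)]
      nlinarith [sq_abs p, sq_abs q, mul_nonneg hp hq]
    have hS0 := Real.sqrt_nonneg (p ^ 2 + q ^ 2)
    calc p ^ 2 + q ^ 2 = √(p ^ 2 + q ^ 2) * √(p ^ 2 + q ^ 2) :=
          (Real.mul_self_sqrt (by positivity)).symm
      _ ≤ _ := mul_le_mul hS' hS hS0 (by positivity)
  have h₂ : |p * α + q * β| ≤ (|p| + |q|) / 8 := by
    have : ρ * |p * α + q * β| ≤ ρ * ((|p| + |q|) / 8) := by linarith
    exact le_of_mul_le_mul_left this hρ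
  have h₃ : |p| * |α| ≤ |q| * |β| + |p * α + q * β| := by
    have := abs_sub (p * α + q * β) (q * β)
    rw [add_sub_cancel_right, abs_mul, abs_mul] at this
    linarith
  have h₄ : |p| * |α| ≤ (|q| + (|p| + |q|) / 4) * |α| := by nlinarith
  have h₅ := le_of_mul_le_mul_right h₄ (by linarith)
  linarith

/-- The points near `c`, at distance at least `ρ` from `F`, that are midpoints of two nearest points
lying in a direction in which the coordinate `i` dominates the coordinate `j`. -/
def midPoints (F : Set Plane) (i j : Fin 2) (c : Plane) (ρ : ℝ) : Set Plane :=
  {a | dist a c ≤ ρ / 16 ∧ ρ ≤ distFun F a ∧ ∃ u : Plane, u 0 ^ 2 + u 1 ^ 2 = 1 ∧ |u j| ≤ |u i| ∧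
    a + distFun F a • u ∈ F ∧ a - distFun F a • u ∈ F}

/-- With the direction `u` kept as an extra variable all conditions are closed and bounded, and the
set is a projection. -/
theorem isCompact_midPoints {F : Set Plane} (hF : IsClosed F) (i j : Fin 2) (c : Plane) (ρ : ℝ) :
    IsCompact (midPoints F i j c ρ) := by
  set P : Set (Plane × Plane) := {p | dist p.1 c ≤ ρ / 16 ∧ ρ ≤ distFun F p.1 ∧
    p.2 0 ^ 2 + p.2 1 ^ 2 = 1 ∧ |p.2 j| ≤ |p.2 i| ∧
    p.1 + distFun F p.1 • p.2 ∈ F ∧ p.1 - distFun F p.1 • p.2 ∈ F}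
  have hd : Continuous fun p : Plane × Plane => distFun F p.1 :=
    (continuous_distFun F).comp continuous_fst
  have hP : IsCompact P := by
    refine Metric.isCompact_of_isClosed_isBounded ?_ ?_
    · have c₁ : IsClosed {p : Plane × Plane | dist p.1 c ≤ ρ / 16} :=
        isClosed_le (by fun_prop) continuous_const
      have c₂ : IsClosed {p : Plane × Plane | ρ ≤ distFun F p.1} := isClosed_le continuous_const hd
      have c₃ : IsClosed {p : Plane × Plane | p.2 0 ^ 2 + p.2 1 ^ 2 = 1} :=
        isClosed_eq (by fun_prop) continuous_const
      have c₄ : IsClosed {p : Plane × Plane | |p.2 j| ≤ |p.2 i|} :=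
        isClosed_le (by fun_prop) (by fun_prop)
      have c₅ : IsClosed {p : Plane × Plane | p.1 + distFun F p.1 • p.2 ∈ F} :=
        hF.preimage (continuous_fst.add (hd.smul continuous_snd))
      have c₆ : IsClosed {p : Plane × Plane | p.1 - distFun F p.1 • p.2 ∈ F} :=
        hF.preimage (continuous_fst.sub (hd.smul continuous_snd))
      exact c₁.inter (c₂.inter (c₃.inter (c₄.inter (c₅.inter c₆))))
    · refine ((Metric.isBounded_closedBall (x := c) (r := ρ / 16)).prod
        (Metric.isBounded_closedBall (x := (0 : Plane)) (r := 1))).subset ?_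
      rintro ⟨a, u⟩ ⟨h₁, -, h₂, -⟩
      refine ⟨h₁, ?_⟩
      rw [mem_closedBall_zero_iff]
      have := norm_sq_plane u
      simp only at h₂
      rw [h₂] at this
      nlinarith [norm_nonneg u]
  convert hP.image continuous_fst
  ext a
  simp only [midPoints, mem_ofPred_eq, P, mem_image, Prod.exists, exists_and_right, exists_eq_right]
  tauto

/-- The antipodal inequality in both orders serves twice: the sum shows that `b - a` is nearly
orthogonal to `u`, so that coordinate `j` controls its length, and each one separately bounds the
difference of the squared distances. -/
theorem abs_sub_le_of_mem_midPoints {F : Set Plane} {i j : Fin 2} (hij : i ≠ j) {c : Plane} {ρ : ℝ}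
    (hρ : 0 < ρ) {a b : Plane} (ha : a ∈ midPoints F i j c ρ) (hb : b ∈ midPoints F i j c ρ) :
    |distFun F a - distFun F b| ≤ 5 / (2 * ρ) * (a j - b j) ^ 2 := by
  obtain ⟨hac, haρ, w, hw, -, hw₁, hw₂⟩ := ha
  obtain ⟨hbc, hbρ, u, hu, hu', hu₁, hu₂⟩ := hb
  have h₁ := antipodal_inequality (a := a) hu hu₁ hu₂
  have h₂ := antipodal_inequality (a := b) hw hw₁ hw₂
  set r := distFun F a
  set s := distFun F b
  have hN : (b 0 - a 0) ^ 2 + (b 1 - a 1) ^ 2 ≤ (ρ / 8) ^ 2 := by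
    rw [← dist_sq_plane]
    have := dist_triangle_right b a c
    exact pow_le_pow_left₀ dist_nonneg (by linarith) 2
  have h₃ : 0 ≤ 2 * r * |(a 0 - b 0) * w 0 + (a 1 - b 1) * w 1| := by
    have : 0 ≤ r := by linarith
    positivity
  have h₄ : ρ * |(b 0 - a 0) * u 0 + (b 1 - a 1) * u 1| ≤ (b 0 - a 0) ^ 2 + (b 1 - a 1) ^ 2 := by
    have := mul_le_mul_of_nonneg_right hbρ (abs_nonneg ((b 0 - a 0) * u 0 + (b 1 - a 1) * u 1))
    linarith
  have h₄' : 0 ≤ 2 * s * |(b 0 - a 0) * u 0 + (b 1 - a 1) * u 1| := by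
    have : 0 ≤ s := by linarith
    positivity
  -- The factor is `5 = 2² + 1`, from the coordinate `i` being at most twice the coordinate `j`.
  have h₅ : (b 0 - a 0) ^ 2 + (b 1 - a 1) ^ 2 ≤ 5 * (a j - b j) ^ 2 := by
    have hcases : (i = 0 ∧ j = 1) ∨ (i = 1 ∧ j = 0) := by
      fin_cases i <;> fin_cases j <;> simp_all
    rcases hcases with ⟨rfl, rfl⟩ | ⟨rfl, rfl⟩
    · have := abs_le_two_mul_abs_of_nearly_orthogonal hρ hN hu hu' h₄
      nlinarith [sq_abs (b 0 - a 0), sq_abs (b 1 - a 1), abs_nonneg (b 0 - a 0),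
        abs_nonneg (b 1 - a 1)]
    · have := abs_le_two_mul_abs_of_nearly_orthogonal (p := b 1 - a 1) (q := b 0 - a 0)
        (α := u 1) (β := u 0) hρ (by linarith) (by linarith) hu'
        (by rw [add_comm ((b 1 - a 1) * u 1)]; linarith)
      nlinarith [sq_abs (b 0 - a 0), sq_abs (b 1 - a 1), abs_nonneg (b 0 - a 0),
        abs_nonneg (b 1 - a 1)]
  have h₆ : |r - s| * (r + s) ≤ 5 * (a j - b j) ^ 2 := by
    have : |r - s| * (r + s) = |r ^ 2 - s ^ 2| := by
      rw [show r ^ 2 - s ^ 2 = (r - s) * (r + s) by ring, abs_mul,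
        abs_of_nonneg (show 0 ≤ r + s by linarith)]
    rw [this, abs_le]
    constructor <;> nlinarith
  rw [div_mul_eq_mul_div, le_div_iff₀ (by positivity)]
  have h₇ := mul_le_mul_of_nonneg_left (show 2 * ρ ≤ r + s by linarith) (abs_nonneg (r - s))
  linarith

theorem isBT_image_midPoints {F : Set Plane} (hF : IsClosed F) {i j : Fin 2} (hij : i ≠ j)
    (c : Plane) {ρ : ℝ} (hρ : 0 < ρ) : IsBT (1 / 2) (distFun F '' midPoints F i j c ρ) :=
  isBT_image (isCompact_midPoints hF i j c ρ) (π := fun a => a j) (by fun_prop) (by fun_prop)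
    (by positivity) fun _ ha _ hb => abs_sub_le_of_mem_midPoints hij hρ ha hb

theorem exists_mem_midPoints {F : Set Plane} {a u : Plane} (ha : 0 < distFun F a)
    (hu : u 0 ^ 2 + u 1 ^ 2 = 1) (h₁ : a + distFun F a • u ∈ F) (h₂ : a - distFun F a • u ∈ F) :
    ∃ m k : ℕ, a ∈ midPoints F 0 1 (TopologicalSpace.denseSeq Plane k) (1 / (m + 1)) ∨
      a ∈ midPoints F 1 0 (TopologicalSpace.denseSeq Plane k) (1 / (m + 1)) := by
  obtain ⟨m, hm⟩ := exists_nat_one_div_lt ha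
  obtain ⟨k, hk⟩ := (TopologicalSpace.denseRange_denseSeq Plane).exists_dist_lt a
    (ε := 1 / ((m : ℝ) + 1) / 16) (by positivity)
  refine ⟨m, k, ?_⟩
  rcases le_total |u 1| |u 0| with h | h
  · exact Or.inl ⟨hk.le, hm.le, u, hu, h, h₁, h₂⟩
  · exact Or.inr ⟨hk.le, hm.le, u, hu, h, h₁, h₂⟩

theorem critValues_subset_iUnion {F : Set Plane} (hF : IsClosed F) (hne : F.Nonempty) :
    ∃ K : ℕ → Set ℝ, (∀ n, IsBT (1 / 2) (K n)) ∧ critValues (distFun F) ⊆ ⋃ n, K n := by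
  set S₁ : Set (Set ℝ) :=
    ⋃ n : ℕ, (fun a => ({distFun F a} : Set ℝ)) '' deepPoints F (1 / (n + 1))
  set S₂ : (Fin 2) → (Fin 2) → Set (Set ℝ) := fun i j => range fun p : ℕ × ℕ =>
    distFun F '' midPoints F i j (TopologicalSpace.denseSeq Plane p.2) (1 / (p.1 + 1))
  refine exists_nat_cover_of_countable (S := insert {0} (S₁ ∪ (S₂ 0 1 ∪ S₂ 1 0))) ?_ ?_ ?_
  · refine Countable.insert _ ((countable_iUnion fun n => ?_).union
      ((countable_range _).union (countable_range _)))
    exact (countable_deepPoints F (by positivity)).image _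
  · rintro B (rfl | hB | ⟨p, rfl⟩ | ⟨p, rfl⟩)
    · exact isBT_singleton 0
    · obtain ⟨n, a, -, rfl⟩ := mem_iUnion.1 hB
      exact isBT_singleton _
    · exact isBT_image_midPoints hF (by decide) _ (by positivity)
    · exact isBT_image_midPoints hF (by decide) _ (by positivity)
  · rintro _ ⟨a, ha, rfl⟩
    rcases (distFun_nonneg F a).eq_or_lt with h0 | hpos
    · exact ⟨{0}, Or.inl rfl, h0.symm⟩
    rcases mem_deepPoints_or_antipodal hF
      (exists_nearestPoint_of_mem_critPoints hF hne hpos ha) with ⟨n, hn⟩ | ⟨u, hu, h₁, h₂⟩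
    · exact ⟨_, Or.inr (Or.inl (mem_iUnion.2 ⟨n, a, hn, rfl⟩)), rfl⟩
    · obtain ⟨m, k, h | h⟩ := exists_mem_midPoints hpos hu h₁ h₂
      · exact ⟨_, Or.inr (Or.inr (Or.inl ⟨(m, k), rfl⟩)), a, h, rfl⟩
      · exact ⟨_, Or.inr (Or.inr (Or.inr ⟨(m, k), rfl⟩)), a, h, rfl⟩

/-! ### Level sets of functions that decrease in one variable -/

theorem abs_sub_le_of_level {f : ℝ → ℝ → ℝ} {c L : ℝ} {T : Set ℝ} {s s' τ τ' : ℝ}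
    (hlip : ∀ τ ∈ T, |f s τ - f s' τ| ≤ L * |s - s'|)
    (hdec : ∀ τ ∈ T, ∀ τ' ∈ T, τ ≤ τ' → f s τ' ≤ f s τ - c * (τ' - τ))
    (hτ : τ ∈ T) (hτ' : τ' ∈ T) (h : f s τ = f s' τ') : c * |τ - τ'| ≤ L * |s - s'| := by
  have h₁ := abs_le.1 (hlip τ' hτ')
  rcases le_total τ τ' with h₂ | h₂
  · have := hdec τ hτ τ' hτ' h₂
    rw [abs_of_nonpos (by linarith : τ - τ' ≤ 0)]
    linarith [h₁.1]
  · have := hdec τ' hτ' τ hτ h₂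
    rw [abs_of_nonneg (by linarith : 0 ≤ τ - τ')]
    linarith [h₁.2]

/-- Near a noncritical point a function decreases at a uniform rate in some direction. -/
theorem exists_descent_of_notMem_critPoints {f : Plane → ℝ} {a : Plane} (ha : a ∉ critPoints f) :
    ∃ (v : Plane) (c ε : ℝ), 0 < c ∧ 0 < ε ∧
      ∀ z, dist z a < ε → ∀ t, 0 < t → t < ε → f (z + t • v) ≤ f z - c * t := by
  have h : ∃ v, clarkeDeriv f a v < 0 := by
    by_contra! h
    exact ha fun v => by simpa using h v
  obtain ⟨v, hv⟩ := h
  obtain ⟨c, hc₁, hc₂⟩ := EReal.lt_iff_exists_real_btwn.1 hv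
  have hc0 : c < 0 := by exact_mod_cast hc₂
  have hev := eventually_lt_of_limsup_lt hc₁
  obtain ⟨U, hU, T, hT, h⟩ := Filter.eventually_prod_iff.1 hev
  obtain ⟨ε₁, hε₁, hball⟩ := Metric.eventually_nhds_iff.1 hU
  obtain ⟨ε₂, hε₂, hIoo⟩ := mem_nhdsGT_iff_exists_Ioo_subset.1 hT
  refine ⟨v, -c, min ε₁ ε₂, by linarith, lt_min hε₁ hε₂, fun z hz t ht ht' => ?_⟩
  have := h (hball (hz.trans_le (min_le_left _ _)))
    (hIoo ⟨ht, ht'.trans_le (min_le_right _ _)⟩)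
  rw [EReal.coe_lt_coe_iff, div_lt_iff₀ ht] at this
  linarith

theorem dist_fin_one (x y : EuclideanSpace ℝ (Fin 1)) : dist x y = |x 0 - y 0| := by
  rw [EuclideanSpace.dist_eq, Fin.sum_univ_one, Real.sqrt_sq dist_nonneg, Real.dist_eq]

/-- In coordinates `s` across and `τ` along a descent direction, `d_F` is Lipschitz in `s` and
decreases in `τ` at a definite rate. Locally each line `s = const` thus meets the level set exactly
once, in a Lipschitz graph, and `s` is a bilipschitz chart. -/
theorem isLipManifold_of_forall_notMem_critPoints {F : Set Plane} {r : ℝ}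
    (h : ∀ a ∈ distSphere F r, a ∉ critPoints (distFun F)) : IsLipManifold 1 (distSphere F r) := by
  rintro ⟨a, ha⟩
  have har : distFun F a = r := ha
  obtain ⟨v, c, ε, hc, hε, hdesc⟩ := exists_descent_of_notMem_critPoints (h a ha)
  set V := √(v 0 ^ 2 + v 1 ^ 2) with hVdef
  have hV2 : V ^ 2 = v 0 ^ 2 + v 1 ^ 2 := Real.sq_sqrt (by positivity)
  have hV : 0 < V := by
    refine (Real.sqrt_nonneg _).lt_of_ne' fun h0 => ?_
    have hv : v = 0 := by
      rw [← norm_eq_zero, ← sq_eq_zero_iff, norm_sq_plane, ← hV2, hVdef, h0]; norm_num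
    have := hdesc a (by simpa using hε) (ε / 2) (by linarith) (by linarith)
    rw [hv, smul_zero, add_zero] at this
    nlinarith
  set n : Plane := !₂[-v 1, v 0]
  have hn0 : n 0 = -v 1 := rfl
  have hn1 : n 1 = v 0 := rfl
  set P : ℝ → ℝ → Plane := fun s τ => a + s • n + τ • v
  have hP0 : ∀ s τ, P s τ 0 = a 0 - s * v 1 + τ * v 0 := by
    intro s τ; simp [P, n]; ring
  have hP1 : ∀ s τ, P s τ 1 = a 1 + s * v 0 + τ * v 1 := by
    intro s τ; simp [P, n]
  set S : Plane → ℝ := fun x => (-(x 0 - a 0) * v 1 + (x 1 - a 1) * v 0) / V ^ 2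
  set Tc : Plane → ℝ := fun x => ((x 0 - a 0) * v 0 + (x 1 - a 1) * v 1) / V ^ 2
  have hPST : ∀ x, P (S x) (Tc x) = x := by
    intro x
    refine plane_ext ?_ ?_
    · rw [hP0]; simp only [S, Tc]; field_simp; rw [hV2]; ring
    · rw [hP1]; simp only [S, Tc]; field_simp; rw [hV2]; ring
  have hSP : ∀ s τ, S (P s τ) = s := by
    intro s τ; simp only [S, hP0, hP1]; rw [hV2]; field_simp [hV2 ▸ (pow_pos hV 2).ne']; ring
  have hTP : ∀ s τ, Tc (P s τ) = τ := by
    intro s τ; simp only [Tc, hP0, hP1]; rw [hV2]; field_simp [hV2 ▸ (pow_pos hV 2).ne']; ring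
  have hdist : ∀ s τ s' τ', dist (P s τ) (P s' τ') ^ 2 =
      V ^ 2 * ((s - s') ^ 2 + (τ - τ') ^ 2) := by
    intro s τ s' τ'; rw [dist_sq_plane, hV2]; simp only [hP0, hP1]; ring
  have hdist_le : ∀ s τ s' τ', dist (P s τ) (P s' τ') ≤ V * (|s - s'| + |τ - τ'|) := by
    intro s τ s' τ'
    refine abs_le_of_sq_le_sq' ?_ (by positivity) |>.2
    rw [hdist, mul_pow]
    refine mul_le_mul_of_nonneg_left ?_ (by positivity)
    nlinarith [sq_abs (s - s'), sq_abs (τ - τ'), mul_nonneg (abs_nonneg (s - s'))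
      (abs_nonneg (τ - τ'))]
  have hle_dist : ∀ s τ s' τ', V * |s - s'| ≤ dist (P s τ) (P s' τ') := by
    intro s τ s' τ'
    refine abs_le_of_sq_le_sq' ?_ dist_nonneg |>.2
    rw [hdist, mul_pow, sq_abs]
    refine mul_le_mul_of_nonneg_left ?_ (by positivity)
    nlinarith [sq_nonneg (τ - τ')]
  have hPa : P 0 0 = a := by simp [P]
  -- These bounds keep the patch `|s| < η`, `|τ| < 2 * η` within the ball of descent, and the
  -- increments of `τ` within the admissible step.
  obtain ⟨η, hη, hη₁, hη₂⟩ : ∃ η > 0, V * (3 * η) < ε ∧ 4 * η < ε := by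
    refine ⟨min (ε / (6 * V)) (ε / 8), by positivity, ?_, ?_⟩
    · have := min_le_left (ε / (6 * V)) (ε / 8)
      rw [le_div_iff₀ (by positivity)] at this
      nlinarith
    · have := min_le_right (ε / (6 * V)) (ε / 8)
      linarith
  -- Over `|s| < σ` the sideways change cannot outweigh the change `c * η` along `v`, so the values
  -- at `τ = ±η` still bracket `r`.
  obtain ⟨σ, hσ, hση, hσV⟩ : ∃ σ > 0, σ ≤ η ∧ V * σ ≤ c * η := by
    refine ⟨min η (c * η / V), by positivity, min_le_left _ _, ?_⟩
    have := min_le_right η (c * η / V)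
    rwa [le_div_iff₀ hV, mul_comm] at this
  set f : ℝ → ℝ → ℝ := fun s τ => distFun F (P s τ)
  have hlip : ∀ s s' τ, |f s τ - f s' τ| ≤ V * |s - s'| := by
    intro s s' τ
    have h₁ := (Metric.lipschitz_infDist_pt F).dist_le_mul (P s τ) (P s' τ)
    have h₂ := hdist_le s τ s' τ
    rw [Real.dist_eq] at h₁
    simp only [NNReal.coe_one, one_mul, sub_self, abs_zero, add_zero] at h₁ h₂
    exact h₁.trans h₂
  have hdec : ∀ s, |s| < σ → ∀ τ ∈ Ioo (-(2 * η)) (2 * η), ∀ τ' ∈ Ioo (-(2 * η)) (2 * η), τ ≤ τ' →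
      f s τ' ≤ f s τ - c * (τ' - τ) := by
    intro s hs τ hτ τ' hτ' hle
    rcases hle.eq_or_lt with rfl | hlt
    · simp
    have h₁ := hdesc (P s τ) (by
      have h₁ := hdist_le s τ 0 0
      rw [hPa, sub_zero, sub_zero] at h₁
      have h₂ : |τ| < 2 * η := abs_lt.2 hτ
      have : V * (|s| + |τ|) < V * (3 * η) := mul_lt_mul_of_pos_left (by linarith) hV
      linarith) (τ' - τ) (by linarith) (by linarith [hτ.1, hτ'.2])
    have h₂ : P s τ + (τ' - τ) • v = P s τ' := by
      simp only [P, sub_smul]; abel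
    rwa [h₂] at h₁
  have hroot : ∀ s, |s| < σ → ∃ τ ∈ Ioo (-(2 * η)) (2 * η), f s τ = r := by
    intro s hs
    have hcont : Continuous (f s) := by simp only [f, P]; fun_prop
    have m₀ : (0 : ℝ) ∈ Ioo (-(2 * η)) (2 * η) := ⟨by linarith, by linarith⟩
    have m₁ : η ∈ Ioo (-(2 * η)) (2 * η) := ⟨by linarith, by linarith⟩
    have m₂ : -η ∈ Ioo (-(2 * η)) (2 * η) := ⟨by linarith, by linarith⟩
    have hf0 : f 0 0 = r := by simp only [f, hPa]; exact har
    have h₁ := hdec 0 (by simpa using hσ) 0 m₀ η m₁ hη.le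
    have h₂ := hdec 0 (by simpa using hσ) (-η) m₂ 0 m₀ (by linarith)
    have h₃ := abs_le.1 (hlip s 0 η)
    have h₄ := abs_le.1 (hlip s 0 (-η))
    rw [sub_zero] at h₃ h₄
    have h₅ : V * |s| ≤ V * σ := mul_le_mul_of_nonneg_left hs.le hV.le
    obtain ⟨τ, hτ, hτr⟩ := intermediate_value_Icc' (show -η ≤ η by linarith) hcont.continuousOn
      (show r ∈ Icc (f s η) (f s (-η)) from ⟨by linarith [h₃.2], by linarith [h₄.1]⟩)
    exact ⟨τ, ⟨by linarith [hτ.1], by linarith [hτ.2]⟩, hτr⟩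
  have hSc : Continuous S := by simp only [S]; fun_prop
  have hTcc : Continuous Tc := by simp only [Tc]; fun_prop
  set U : Set (distSphere F r) := {x | |S x| < σ ∧ Tc x ∈ Ioo (-(2 * η)) (2 * η)}
  have hUo : IsOpen U := by
    have o₁ : IsOpen {x : distSphere F r | |S x| < σ} :=
      isOpen_lt (hSc.comp continuous_subtype_val).abs continuous_const
    have o₂ : IsOpen {x : distSphere F r | Tc x ∈ Ioo (-(2 * η)) (2 * η)} :=
      isOpen_Ioo.preimage (hTcc.comp continuous_subtype_val)
    exact o₁.inter o₂
  set W : Set (EuclideanSpace ℝ (Fin 1)) := {w | |w 0| < σ}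
  have hWo : IsOpen W := isOpen_lt (by fun_prop) continuous_const
  have hfx : ∀ x : U, f (S x) (Tc x) = r := by
    intro x; simp only [f, hPST]; exact x.1.2
  have hτs : ∀ x x' : U, c * |Tc x - Tc x'| ≤ V * |S x - S x'| := fun x x' =>
    abs_sub_le_of_level (T := Ioo (-(2 * η)) (2 * η)) (fun τ _ => hlip _ _ τ) (hdec _ x.2.1)
      x.2.2 x'.2.2 ((hfx x).trans (hfx x').symm)
  set φ : U → W := fun x => ⟨!₂[S x], by simpa [W] using x.2.1⟩
  have hφ : ∀ x x' : U, dist (φ x) (φ x') = |S x - S x'| := by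
    intro x x'
    rw [Subtype.dist_eq, dist_fin_one]; simp [φ]
  have hanti : ∀ x x' : U, dist x x' ≤ V * (1 + V / c) * dist (φ x) (φ x') := by
    intro x x'
    rw [hφ, Subtype.dist_eq, Subtype.dist_eq]
    have h₁ := hdist_le (S x) (Tc x) (S x') (Tc x')
    rw [hPST, hPST] at h₁
    refine h₁.trans ?_
    rw [mul_assoc]
    refine mul_le_mul_of_nonneg_left ?_ hV.le
    have h₂ : |Tc x - Tc x'| ≤ V / c * |S x - S x'| := by
      rw [div_mul_eq_mul_div, le_div_iff₀ hc, mul_comm]; exact hτs x x'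
    linarith
  have hbij : Function.Bijective φ := by
    constructor
    · intro x x' hxx
      have := hanti x x'
      rw [hxx, dist_self, mul_zero] at this
      exact dist_le_zero.1 this
    · rintro ⟨w, hw⟩
      obtain ⟨τ, hτ, hτr⟩ := hroot (w 0) hw
      refine ⟨⟨⟨P (w 0) τ, hτr⟩, by simpa only [U, mem_ofPred_eq, hSP, hTP] using ⟨hw, hτ⟩⟩, ?_⟩
      apply Subtype.ext
      ext i
      fin_cases i
      simp [φ, hSP]
  refine ⟨U, hUo, ?_, W, hWo, Equiv.ofBijective φ hbij, ⟨V⁻¹.toNNReal, ?_⟩,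
    ⟨(V * (1 + V / c)).toNNReal, ?_⟩⟩
  · have hS0 : S a = 0 := by simp [S]
    have hT0 : Tc a = 0 := by simp [Tc]
    simp only [U, mem_ofPred_eq, hS0, hT0, abs_zero]
    exact ⟨hσ, by linarith, by linarith⟩
  · refine LipschitzWith.of_dist_le_mul fun x x' => ?_
    rw [Real.coe_toNNReal _ (by positivity), Equiv.ofBijective_apply, Equiv.ofBijective_apply, hφ,
      ← div_eq_inv_mul, le_div_iff₀ hV, mul_comm]
    have := hle_dist (S x) (Tc x) (S x') (Tc x')
    rwa [hPST, hPST] at this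
  · refine LipschitzWith.of_dist_le_mul fun w w' => ?_
    rw [Real.coe_toNNReal _ (by positivity)]
    have := hanti ((Equiv.ofBijective φ hbij).symm w) ((Equiv.ofBijective φ hbij).symm w')
    have e : ∀ w, φ ((Equiv.ofBijective φ hbij).symm w) = w :=
      Equiv.ofBijective_apply_symm_apply φ hbij
    rwa [e, e] at this

theorem lipExceptional_subset_critValues (F : Set Plane) :
    lipExceptional F ⊆ critValues (distFun F) := by
  rintro r ⟨-, -, hr⟩
  by_contra hcon
  exact hr (isLipManifold_of_forall_notMem_critPoints fun a ha hc => hcon ⟨a, hc, ha⟩)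

theorem IsLipManifold.isTopManifold {k : ℕ} {X : Type*} [MetricSpace X] (h : IsLipManifold k X) :
    IsTopManifold k X := by
  intro a
  obtain ⟨U, hU, ha, V, hV, φ, ⟨K, hK⟩, ⟨K', hK'⟩⟩ := h a
  exact ⟨U, hU, ha, V, hV, ⟨⟨φ, hK.continuous, hK'.continuous⟩⟩⟩

theorem topExceptional_subset_lipExceptional (F : Set Plane) :
    topExceptional F ⊆ lipExceptional F :=
  fun _ ⟨h₀, h₁, h₂⟩ => ⟨h₀, h₁, fun h => h₂ h.isTopManifold⟩

/-! ### Cusps are not Lipschitz manifolds -/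

/-- The chart is normalised to vanish at `a` and extended by the irrelevant value `0`, which avoids
subtypes later. -/
theorem IsLipManifold.exists_chart {S : Set Plane} (h : IsLipManifold 1 S) {a : Plane}
    (ha : a ∈ S) : ∃ (ρ K : ℝ) (Φ : Plane → ℝ), 0 < ρ ∧ 0 < K ∧ Φ a = 0 ∧
      ∀ z ∈ S, dist z a < ρ → ∀ z' ∈ S, dist z' a < ρ →
        |Φ z - Φ z'| ≤ K * dist z z' ∧ dist z z' ≤ K * |Φ z - Φ z'| := by
  obtain ⟨U, hU, haU, V, -, φ, ⟨K₁, hK₁⟩, ⟨K₂, hK₂⟩⟩ := h ⟨a, ha⟩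
  obtain ⟨ρ, hρ, hball⟩ := Metric.isOpen_iff.1 hU _ haU
  have hmem : ∀ z (hz : z ∈ S), dist z a < ρ → (⟨z, hz⟩ : S) ∈ U := fun z hz hd => hball hd
  classical
  refine ⟨ρ, K₁ + K₂ + 1, fun z => if hz : ∃ hz : z ∈ S, (⟨z, hz⟩ : S) ∈ U then
    (φ ⟨⟨z, hz.1⟩, hz.2⟩ : EuclideanSpace ℝ (Fin 1)) 0 -
      (φ ⟨⟨a, ha⟩, haU⟩ : EuclideanSpace ℝ (Fin 1)) 0 else 0, hρ, by positivity, ?_, ?_⟩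
  · simp
  · intro z hz hzρ z' hz' hzρ'
    have e : ∃ hz : z ∈ S, (⟨z, hz⟩ : S) ∈ U := ⟨hz, hmem z hz hzρ⟩
    have e' : ∃ hz : z' ∈ S, (⟨z', hz⟩ : S) ∈ U := ⟨hz', hmem z' hz' hzρ'⟩
    simp only [dif_pos e, dif_pos e', sub_sub_sub_cancel_right]
    rw [← dist_fin_one, ← Subtype.dist_eq]
    have h₁ := hK₁.dist_le_mul ⟨⟨z, hz⟩, e.2⟩ ⟨⟨z', hz'⟩, e'.2⟩
    have h₂ := hK₂.dist_le_mul (φ ⟨⟨z, hz⟩, e.2⟩) (φ ⟨⟨z', hz'⟩, e'.2⟩)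
    rw [Equiv.symm_apply_apply, Equiv.symm_apply_apply] at h₂
    rw [Subtype.dist_eq, Subtype.dist_eq] at h₁ h₂
    refine ⟨h₁.trans (mul_le_mul_of_nonneg_right ?_ dist_nonneg),
      h₂.trans (mul_le_mul_of_nonneg_right ?_ dist_nonneg)⟩
    · linarith [K₂.2]
    · linarith [K₁.2]

/-- Both functions tend to `0` at `0`, so the one with the larger value at `δ / 2` takes the smaller
of the two values on the way. -/
theorem exists_eq_of_pos_of_le_mul {g h : ℝ → ℝ} {δ M : ℝ} (hδ : 0 < δ)
    (hg : ContinuousOn g (Ioo 0 δ)) (hh : ContinuousOn h (Ioo 0 δ))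
    (hg0 : ∀ x ∈ Ioo 0 δ, 0 < g x ∧ g x ≤ M * x) (hh0 : ∀ x ∈ Ioo 0 δ, 0 < h x ∧ h x ≤ M * x) :
    ∃ x ∈ Ioo 0 δ, ∃ x' ∈ Ioo 0 δ, g x = h x' := by
  have key : ∀ g h : ℝ → ℝ, ContinuousOn g (Ioo 0 δ) → (∀ x ∈ Ioo 0 δ, 0 < g x ∧ g x ≤ M * x) →
      (∀ x ∈ Ioo 0 δ, 0 < h x) → h (δ / 2) ≤ g (δ / 2) → ∃ x ∈ Ioo 0 δ, g x = h (δ / 2) := by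
    intro g h hg hg0 hh0 hle
    have hm : δ / 2 ∈ Ioo 0 δ := ⟨by linarith, by linarith⟩
    have hβ := hh0 _ hm
    have hM : 0 < M := by
      obtain ⟨h₁, h₂⟩ := hg0 _ hm
      by_contra! hM
      nlinarith
    set x₀ := min (δ / 2) (h (δ / 2) / M)
    have hx₀ : 0 < x₀ := by positivity
    have hx₀' : x₀ ≤ δ / 2 := min_le_left _ _
    have hgx₀ : g x₀ ≤ h (δ / 2) := by
      refine (hg0 x₀ ⟨hx₀, by linarith⟩).2.trans ?_
      have : x₀ ≤ h (δ / 2) / M := min_le_right _ _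
      rwa [le_div_iff₀ hM, mul_comm] at this
    obtain ⟨x, hx, hgx⟩ := intermediate_value_Icc hx₀'
      (hg.mono fun x hx => ⟨hx₀.trans_le hx.1, by linarith [hx.2]⟩) ⟨hgx₀, hle⟩
    exact ⟨x, ⟨hx₀.trans_le hx.1, by linarith [hx.2]⟩, hgx⟩
  have hm : δ / 2 ∈ Ioo 0 δ := ⟨by linarith, by linarith⟩
  rcases le_total (h (δ / 2)) (g (δ / 2)) with hle | hle
  · obtain ⟨x, hx, e⟩ := key g h hg hg0 (fun x hx => (hh0 x hx).1) hle
    exact ⟨x, hx, _, hm, e⟩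
  · obtain ⟨x, hx, e⟩ := key h g hh hh0 (fun x hx => (hg0 x hx).1) hle
    exact ⟨_, hm, x, hx, e.symm⟩

theorem pos_or_neg_of_ne_zero {g : ℝ → ℝ} {δ : ℝ} (hg : ContinuousOn g (Ioo 0 δ))
    (h0 : ∀ x ∈ Ioo 0 δ, g x ≠ 0) : (∀ x ∈ Ioo 0 δ, 0 < g x) ∨ ∀ x ∈ Ioo 0 δ, g x < 0 := by
  by_contra! h
  obtain ⟨⟨x, hx, hgx⟩, x', hx', hgx'⟩ := h
  obtain ⟨z, hz, hgz⟩ := isPreconnected_Ioo.intermediate_value hx hx' hg ⟨hgx, hgx'⟩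
  exact h0 z hz hgz

/-- The set `S` contains two curves starting at `a` that are separated by at most a quadratic
distance. -/
def HasCusp (S : Set Plane) (a : Plane) : Prop :=
  a ∈ S ∧ ∃ (δ C : ℝ) (y : ℝ → ℝ), 0 < δ ∧ ContinuousOn y (Ioo 0 δ) ∧ ∀ x ∈ Ioo 0 δ,
    0 < y x ∧ y x ≤ C * x ^ 2 ∧ a + !₂[x, y x] ∈ S ∧ a + !₂[x, -y x] ∈ S

/-- On each branch the chart vanishes only in the limit at `a`, so it keeps one sign. With equal
signs the images of the branches overlap, against injectivity; with opposite signs the images at `x`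
are at least `2x / K` apart, although the branches are only quadratically far apart. -/
theorem HasCusp.not_isLipManifold {S : Set Plane} {a : Plane} (h : HasCusp S a) :
    ¬ IsLipManifold 1 S := by
  intro hman
  obtain ⟨ha, δ, C, y, hδ, hyc, hy⟩ := h
  obtain ⟨ρ, K, Φ, hρ, hK, hΦa, hΦ⟩ := hman.exists_chart ha
  have hC : 0 < C := by
    obtain ⟨h₁, h₂, -⟩ := hy (δ / 2) ⟨by linarith, by linarith⟩
    by_contra! hC
    nlinarith [sq_nonneg (δ / 2)]
  obtain ⟨d, hd, hdδ, hdρ, hdC⟩ : ∃ d > 0, d ≤ δ ∧ 2 * d < ρ ∧ C * d ≤ 1 := by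
    refine ⟨min δ (min (ρ / 4) (1 / C)), by positivity, min_le_left _ _, ?_, ?_⟩
    · have := (min_le_right δ _).trans (min_le_left (ρ / 4) (1 / C))
      linarith
    · have := (min_le_right δ _).trans (min_le_right (ρ / 4) (1 / C))
      rwa [le_div_iff₀ hC, mul_comm] at this
  have hsub : Ioo 0 d ⊆ Ioo 0 δ := Ioo_subset_Ioo le_rfl hdδ
  -- The sign `e = ±1` selects the branch.
  set p : ℝ → ℝ → Plane := fun e x => a + !₂[x, e * y x]
  have hp0 : ∀ e x, p e x 0 = a 0 + x := fun e x => by simp [p]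
  have hp1 : ∀ e x, p e x 1 = a 1 + e * y x := fun e x => by simp [p]
  have hyle : ∀ x ∈ Ioo 0 d, y x ≤ x := by
    intro x hx
    have h₁ : C * x ≤ C * d := mul_le_mul_of_nonneg_left hx.2.le hC.le
    have h₂ := (hy x (hsub hx)).2.1
    nlinarith [hx.1]
  have hpS : ∀ e, e ^ 2 = 1 → ∀ x ∈ Ioo 0 d, p e x ∈ S := by
    intro e he x hx
    obtain ⟨-, -, h₁, h₂⟩ := hy x (hsub hx)
    rcases sq_eq_one_iff.1 he with rfl | rfl
    · simpa [p] using h₁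
    · simpa [p] using h₂
  have hpa : ∀ e, e ^ 2 = 1 → ∀ x ∈ Ioo 0 d, x ≤ dist (p e x) a ∧ dist (p e x) a ≤ 2 * x := by
    intro e he x hx
    have h₁ : dist (p e x) a ^ 2 = x ^ 2 + y x ^ 2 := by
      rw [dist_sq_plane, hp0, hp1]; linear_combination (y x) ^ 2 * he
    have h₂ := (hy x (hsub hx)).1
    have h₃ := hyle x hx
    exact ⟨(abs_le_of_sq_le_sq' (by nlinarith) dist_nonneg).2,
      (abs_le_of_sq_le_sq' (by nlinarith [hx.1]) (by linarith [hx.1])).2⟩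
  have hpρ : ∀ e, e ^ 2 = 1 → ∀ x ∈ Ioo 0 d, dist (p e x) a < ρ := fun e he x hx => by
    linarith [(hpa e he x hx).2, hx.2]
  have hΦc : ∀ e, e ^ 2 = 1 → ContinuousOn (fun x => Φ (p e x)) (Ioo 0 d) := by
    intro e he
    have hpc : ContinuousOn (p e) (Ioo 0 d) := by
      have := hyc.mono hsub
      simp only [p]
      refine continuousOn_const.add
        ((PiLp.continuous_toLp 2 _).comp_continuousOn (continuousOn_pi.2 fun i => ?_))
      fin_cases i
      · exact continuousOn_id
      · exact continuousOn_const.mul this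
    have hΦl : LipschitzOnWith K.toNNReal Φ (S ∩ Metric.ball a ρ) :=
      LipschitzOnWith.of_dist_le_mul fun z hz z' hz' => by
        rw [Real.coe_toNNReal _ hK.le]
        exact (hΦ z hz.1 hz.2 z' hz'.1 hz'.2).1
    exact hΦl.continuousOn.comp hpc fun x hx => ⟨hpS e he x hx, hpρ e he x hx⟩
  have hbound : ∀ e, e ^ 2 = 1 → ∀ x ∈ Ioo 0 d,
      x ≤ K * |Φ (p e x)| ∧ |Φ (p e x)| ≤ 2 * K * x := by
    intro e he x hx
    have h₁ := hΦ _ (hpS e he x hx) (hpρ e he x hx) a ha (by simpa using hρ)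
    rw [hΦa, sub_zero] at h₁
    obtain ⟨h₂, h₃⟩ := hpa e he x hx
    exact ⟨h₂.trans h₁.2, by nlinarith [h₁.1]⟩
  have hne : ∀ e, e ^ 2 = 1 → ∀ x ∈ Ioo 0 d, Φ (p e x) ≠ 0 := by
    intro e he x hx h0
    have := (hbound e he x hx).1
    rw [h0, abs_zero, mul_zero] at this
    linarith [hx.1]
  have hdisj : ∀ x ∈ Ioo 0 d, ∀ x' ∈ Ioo 0 d, Φ (p 1 x) ≠ Φ (p (-1) x') := by
    intro x hx x' hx' heq
    have h₁ := (hΦ _ (hpS 1 (by norm_num) x hx) (hpρ 1 (by norm_num) x hx) _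
      (hpS (-1) (by norm_num) x' hx') (hpρ (-1) (by norm_num) x' hx')).2
    rw [heq, sub_self, abs_zero, mul_zero] at h₁
    have h₂ := congrArg (fun z : Plane => z 1) (dist_le_zero.1 h₁)
    simp only [hp1] at h₂
    have := (hy x (hsub hx)).1
    have := (hy x' (hsub hx')).1
    linarith
  have hfar : ∀ x ∈ Ioo 0 d, ¬ (2 * x ≤ K * |Φ (p 1 x) - Φ (p (-1) x)|) ∨ 1 ≤ K ^ 2 * C * x := by
    intro x hx
    by_contra! hcon
    obtain ⟨h₁, h₂⟩ := hcon
    have h₃ := (hΦ _ (hpS 1 (by norm_num) x hx) (hpρ 1 (by norm_num) x hx) _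
      (hpS (-1) (by norm_num) x hx) (hpρ (-1) (by norm_num) x hx)).1
    have h₄ := (hy x (hsub hx)).1
    have h₅ : dist (p 1 x) (p (-1) x) ≤ 2 * y x := by
      refine (abs_le_of_sq_le_sq' ?_ (by linarith)).2
      rw [dist_sq_plane, hp0, hp0, hp1, hp1]
      apply le_of_eq; ring
    have h₆ := (hy x (hsub hx)).2.1
    have h₇ : K * |Φ (p 1 x) - Φ (p (-1) x)| ≤ K * (K * (2 * (C * x ^ 2))) :=
      mul_le_mul_of_nonneg_left (h₃.trans (mul_le_mul_of_nonneg_left (by linarith) hK.le)) hK.le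
    have h₈ : K ^ 2 * C * x * x < 1 * x := mul_lt_mul_of_pos_right h₂ hx.1
    nlinarith
  have hopp : ¬ ∀ x ∈ Ioo 0 d, 2 * x ≤ K * |Φ (p 1 x) - Φ (p (-1) x)| := by
    intro hall
    set x := min (d / 2) (1 / (2 * K ^ 2 * C))
    have hx0 : 0 < x := by positivity
    have hx : x ∈ Ioo 0 d := ⟨hx0, by have := min_le_left (d / 2) (1 / (2 * K ^ 2 * C)); linarith⟩
    rcases hfar x hx with h | h
    · exact h (hall x hx)
    · have : x ≤ 1 / (2 * K ^ 2 * C) := min_le_right _ _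
      rw [le_div_iff₀ (by positivity)] at this
      linarith
  have c₁ := hΦc 1 (by norm_num)
  have c₂ := hΦc (-1) (by norm_num)
  have b₁ := hbound 1 (by norm_num)
  have b₂ := hbound (-1) (by norm_num)
  rcases pos_or_neg_of_ne_zero c₁ (hne 1 (by norm_num)) with s₁ | s₁ <;>
    rcases pos_or_neg_of_ne_zero c₂ (hne (-1) (by norm_num)) with s₂ | s₂
  · obtain ⟨x, hx, x', hx', heq⟩ := exists_eq_of_pos_of_le_mul hd c₁ c₂
      (fun x hx => ⟨s₁ x hx, (le_abs_self _).trans (b₁ x hx).2⟩)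
      (fun x hx => ⟨s₂ x hx, (le_abs_self _).trans (b₂ x hx).2⟩)
    exact hdisj x hx x' hx' heq
  · refine hopp fun x hx => ?_
    have h₁ := (b₁ x hx).1
    have h₂ := (b₂ x hx).1
    rw [abs_of_pos (s₁ x hx)] at h₁
    rw [abs_of_neg (s₂ x hx)] at h₂
    rw [abs_of_pos (by linarith [s₁ x hx, s₂ x hx])]
    linarith
  · refine hopp fun x hx => ?_
    have h₁ := (b₁ x hx).1
    have h₂ := (b₂ x hx).1
    rw [abs_of_neg (s₁ x hx)] at h₁
    rw [abs_of_pos (s₂ x hx)] at h₂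
    rw [abs_of_neg (by linarith [s₁ x hx, s₂ x hx])]
    linarith
  · obtain ⟨x, hx, x', hx', heq⟩ := exists_eq_of_pos_of_le_mul hd c₁.neg c₂.neg
      (fun x hx => ⟨neg_pos.2 (s₁ x hx), (neg_le_abs _).trans (b₁ x hx).2⟩)
      (fun x hx => ⟨neg_pos.2 (s₂ x hx), (neg_le_abs _).trans (b₂ x hx).2⟩)
    exact hdisj x hx x' hx' (neg_injective heq)

/-! ### Stretching a `BT` set -/

/-- On `K`, the function adds up `√|I|` over the gaps to the left. Since `K` is null, the gaps
between `r` and `r'` fill `[r, r']`, and each satisfies `|I| ≤ √(r' - r) * √|I|`; summing and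
dividing by `√(r' - r)` gives the bound. -/
theorem IsBT.exists_stretch {K : Set ℝ} (hK : IsBT (1 / 2) K) :
    ∃ φ : ℝ → ℝ, Continuous φ ∧ ∀ r ∈ K, ∀ r' ∈ K, r < r' → √(r' - r) ≤ φ r' - φ r := by
  have hcl := hK.1.isClosed
  have : Countable (gaps K) := (gaps_countable hcl).to_subtype
  choose α hα β hβ hlt heq hdisj using fun I : gaps K => exists_eq_Ioo_of_mem_gaps hcl I.2
  have hpos : ∀ I, 0 < β I - α I := fun I => sub_pos.2 (hlt I)
  have hsum : Summable fun I => √(β I - α I) := by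
    refine hK.summable_sqrt.congr fun I => ?_
    rw [heq I, Real.volume_Ioo, ENNReal.toReal_ofReal (hpos I).le]
  -- A linear ramp across the gap `I`, rising from `0` to `√|I|`; the series of ramps converges
  -- uniformly, so its sum is continuous.
  set g : gaps K → ℝ → ℝ := fun I r => √(β I - α I) * max 0 (min 1 ((r - α I) / (β I - α I)))
  have hg : ∀ I r, ‖g I r‖ ≤ √(β I - α I) := by
    intro I r
    have h₁ : 0 ≤ max 0 (min 1 ((r - α I) / (β I - α I))) := le_max_left _ _
    have h₂ : max 0 (min 1 ((r - α I) / (β I - α I))) ≤ 1 := max_le zero_le_one (min_le_left _ _)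
    rw [Real.norm_of_nonneg (mul_nonneg (Real.sqrt_nonneg _) h₁)]
    exact mul_le_of_le_one_right (Real.sqrt_nonneg _) h₂
  have hgs : ∀ r, Summable fun I => g I r := fun r => hsum.of_norm_bounded (fun I => hg I r)
  have hg1 : ∀ I r, β I ≤ r → g I r = √(β I - α I) := by
    intro I r h
    have : 1 ≤ (r - α I) / (β I - α I) := by rw [le_div_iff₀ (hpos I)]; linarith
    simp only [g, min_eq_left this, max_eq_right zero_le_one, mul_one]
  have hg0 : ∀ I r, r ≤ α I → g I r = 0 := by
    intro I r h
    have : (r - α I) / (β I - α I) ≤ 0 := div_nonpos_of_nonpos_of_nonneg (by linarith) (hpos I).le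
    simp only [g, max_eq_left ((min_le_right _ _).trans this), mul_zero]
  refine ⟨fun r => ∑' I, g I r, continuous_tsum (fun I => ?_) hsum hg, ?_⟩
  · have : Continuous fun r => (r - α I) / (β I - α I) := by fun_prop
    exact continuous_const.mul (continuous_const.max (continuous_const.min this))
  intro r hr r' hr' hrr
  have hd : 0 < √(r' - r) := Real.sqrt_pos.2 (by linarith)
  classical
  set m : gaps K → ℝ := fun I => if r ≤ α I ∧ β I ≤ r' then β I - α I else 0
  have hm0 : ∀ I, 0 ≤ m I := by
    intro I; simp only [m]; split_ifs
    · exact (hpos I).le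
    · exact le_rfl
  have hmg : ∀ I, m I ≤ √(r' - r) * (g I r' - g I r) := by
    intro I
    simp only [m]
    split_ifs with h
    · rw [hg1 I r' h.2, hg0 I r h.1, sub_zero, ← Real.sqrt_mul (by linarith)]
      exact Real.le_sqrt_of_sq_le (by nlinarith [hpos I])
    · rcases le_or_gt (β I) r with h₁ | h₁
      · rw [hg1 I r h₁, hg1 I r' (h₁.trans hrr.le), sub_self, mul_zero]
      · have h₂ : r ≤ α I := by
          by_contra! h₂
          exact hdisj I ⟨h₂, h₁⟩ hr
        have h₃ : r' ≤ α I := by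
          by_contra! h₃
          by_cases h₄ : β I ≤ r'
          · exact h ⟨h₂, h₄⟩
          · exact hdisj I ⟨h₃, not_le.1 h₄⟩ hr'
        rw [hg0 I r h₂, hg0 I r' h₃, sub_self, mul_zero]
  have hds : Summable fun I => √(r' - r) * (g I r' - g I r) := ((hgs r').sub (hgs r)).mul_left _
  have hms : Summable m := hds.of_nonneg_of_le hm0 hmg
  have hvol : r' - r ≤ ∑' I, m I := by
    rw [← ENNReal.ofReal_le_ofReal_iff (tsum_nonneg hm0),
      ENNReal.ofReal_tsum_of_nonneg hm0 hms, ← Real.volume_Icc]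
    have hsub : Icc r r' ⊆ K ∪ ⋃ I : gaps K, if r ≤ α I ∧ β I ≤ r' then (I : Set ℝ) else ∅ := by
      intro x hx
      by_cases hxK : x ∈ K
      · exact Or.inl hxK
      obtain ⟨p, hp, q, hq, hxpq, hpq⟩ := exists_mem_Ioo_subset_compl hcl hxK ⟨r, hr, hx.1⟩
        ⟨r', hr', hx.2⟩
      set I : gaps K := ⟨Ioo p q, Ioo_mem_gaps hp hq (hxpq.1.trans hxpq.2) hpq⟩
      refine Or.inr (mem_iUnion.2 ⟨I, ?_⟩)
      have hxI : x ∈ Ioo (α I) (β I) := by rw [← heq I]; exact hxpq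
      have hc : r ≤ α I ∧ β I ≤ r' := by
        constructor
        · by_contra! h
          exact hdisj I ⟨h, hx.1.trans_lt hxI.2⟩ hr
        · by_contra! h
          exact hdisj I ⟨hxI.1.trans_le hx.2, h⟩ hr'
      rw [if_pos hc]
      exact hxpq
    refine (measure_mono hsub).trans ((measure_union_le _ _).trans ?_)
    rw [hK.2.1, zero_add]
    refine (measure_iUnion_le _).trans (ENNReal.tsum_le_tsum fun I => ?_)
    simp only [m]
    split_ifs
    · rw [heq I, Real.volume_Ioo]
    · simp
  have h₁ : ∑' I, m I ≤ √(r' - r) * (∑' I, g I r' - ∑' I, g I r) := by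
    rw [← (hgs r').tsum_sub (hgs r), ← tsum_mul_left]
    exact hms.tsum_le_tsum hmg hds
  have h₂ : √(r' - r) * √(r' - r) = r' - r := Real.mul_self_sqrt (by linarith)
  exact le_of_mul_le_mul_left (by linarith) hd

/-! ### Two mirror images of a graph -/

/-- The graph of `ψ` over `E`, with exchanged coordinates, together with its mirror image. -/
def mirrorGraph (ψ : ℝ → ℝ) (E : Set ℝ) : Set Plane :=
  (fun r => !₂[ψ r, r]) '' E ∪ (fun r => !₂[ψ r, -r]) '' E

section MirrorGraph

variable {ψ : ℝ → ℝ} {E : Set ℝ}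

theorem isCompact_mirrorGraph (hψ : Continuous ψ) (hE : IsCompact E) :
    IsCompact (mirrorGraph ψ E) := by
  have h : ∀ h : ℝ → ℝ, Continuous h → Continuous fun r => (!₂[ψ r, h r] : Plane) := by
    intro h hh
    refine (PiLp.continuous_toLp 2 _).comp (continuous_pi fun i => ?_)
    fin_cases i
    · exact hψ
    · exact hh
  exact (hE.image (h _ continuous_id)).union (hE.image (h _ continuous_neg))

theorem distFun_mirrorGraph_sq_le {r : ℝ} (hr : r ∈ E) (z : Plane) :
    distFun (mirrorGraph ψ E) z ^ 2 ≤ (z 0 - ψ r) ^ 2 + (z 1 - r) ^ 2 ∧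
      distFun (mirrorGraph ψ E) z ^ 2 ≤ (z 0 - ψ r) ^ 2 + (z 1 + r) ^ 2 := by
  have h₁ := distFun_sq_le (F := mirrorGraph ψ E) (Or.inl ⟨r, hr, rfl⟩) z
  have h₂ := distFun_sq_le (F := mirrorGraph ψ E) (Or.inr ⟨r, hr, rfl⟩) z
  simp only [Matrix.cons_val_zero, Matrix.cons_val_one, sub_neg_eq_add] at h₁ h₂
  exact ⟨h₁, h₂⟩

theorem exists_distFun_mirrorGraph_eq (hψ : Continuous ψ) (hE : IsCompact E) (hne : E.Nonempty)
    (z : Plane) : ∃ r ∈ E, distFun (mirrorGraph ψ E) z ^ 2 = (z 0 - ψ r) ^ 2 + (z 1 - r) ^ 2 ∨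
      distFun (mirrorGraph ψ E) z ^ 2 = (z 0 - ψ r) ^ 2 + (z 1 + r) ^ 2 := by
  obtain ⟨y, hy, hyz⟩ := exists_distFun_eq (isCompact_mirrorGraph hψ hE).isClosed
    (hne.image _ |>.inl) z
  have h := dist_sq_plane z y
  rw [hyz] at h
  rcases hy with ⟨r, hr, rfl⟩ | ⟨r, hr, rfl⟩ <;> refine ⟨r, hr, ?_⟩
  · left; simpa using h
  · right; simpa using h

theorem distFun_mirrorGraph_neg (hψ : Continuous ψ) (hE : IsCompact E) (hne : E.Nonempty)
    (p q : ℝ) : distFun (mirrorGraph ψ E) !₂[p, -q] = distFun (mirrorGraph ψ E) !₂[p, q] := by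
  have key : ∀ q, distFun (mirrorGraph ψ E) !₂[p, -q] ≤ distFun (mirrorGraph ψ E) !₂[p, q] := by
    intro q
    refine (abs_le_of_sq_le_sq' ?_ (distFun_nonneg _ _)).2
    obtain ⟨r, hr, h | h⟩ := exists_distFun_mirrorGraph_eq hψ hE hne !₂[p, q] <;> rw [h]
    · refine (distFun_mirrorGraph_sq_le hr _).2.trans_eq ?_
      simp; ring
    · refine (distFun_mirrorGraph_sq_le hr _).1.trans_eq ?_
      simp; ring
  refine le_antisymm (key q) ?_
  simpa using key (-q)

/-- On the axis, sites with smaller parameter are far enough to the left by `hinc` and those with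
larger parameter are too high, so the distance is `r` at the centre and exceeds `r` to its right.
Slightly above the axis it falls below `r` again because of the site `(ψ r, r)`; the crossing in
between is one branch, and reflection gives the other. -/
theorem hasCusp_mirrorGraph (hψ : Continuous ψ) (hE : IsCompact E) {ρ : ℝ} (hρ : 0 < ρ)
    (hEρ : ∀ r ∈ E, ρ ≤ r)
    (hinc : ∀ r ∈ E, ∀ r' ∈ E, r < r' → ψ r < ψ r' ∧ r' ^ 2 - r ^ 2 ≤ (ψ r' - ψ r) ^ 2)
    {r : ℝ} (hr : r ∈ E) : HasCusp (distSphere (mirrorGraph ψ E) r) !₂[ψ r, 0] := by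
  have hne : E.Nonempty := ⟨r, hr⟩
  have hr0 : 0 < r := hρ.trans_le (hEρ r hr)
  set F := mirrorGraph ψ E
  set f : ℝ → ℝ → ℝ := fun s τ => distFun F !₂[ψ r + s, τ]
  have hf0 : ∀ s τ, 0 ≤ f s τ := fun s τ => distFun_nonneg _ _
  have hup : ∀ t ∈ E, ∀ s τ, f s τ ^ 2 ≤ (ψ r + s - ψ t) ^ 2 + (τ - t) ^ 2 := by
    intro t ht s τ
    simpa [f] using (distFun_mirrorGraph_sq_le (ψ := ψ) ht !₂[ψ r + s, τ]).1
  -- In the upper half-plane a mirrored site is never nearer than the site itself.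
  have hlow : ∀ s τ, 0 ≤ τ → ∃ t ∈ E, (ψ r + s - ψ t) ^ 2 + (τ - t) ^ 2 ≤ f s τ ^ 2 := by
    intro s τ hτ
    obtain ⟨t, ht, h | h⟩ := exists_distFun_mirrorGraph_eq hψ hE hne !₂[ψ r + s, τ]
    · refine ⟨t, ht, ?_⟩
      simp only [f, F]; rw [h]; simp
    · refine ⟨t, ht, ?_⟩
      simp only [f, F]; rw [h]
      simp only [Matrix.cons_val_zero, Matrix.cons_val_one]
      nlinarith [hEρ t ht]
  have hbase : ∀ s, 0 ≤ s → r ^ 2 ≤ f s 0 ^ 2 ∧ (0 < s → r ^ 2 < f s 0 ^ 2) := by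
    intro s hs
    obtain ⟨t, ht, h⟩ := hlow s 0 le_rfl
    have htρ := hEρ t ht
    rcases lt_trichotomy t r with hlt | rfl | hlt
    · obtain ⟨h₁, h₂⟩ := hinc t ht r hr hlt
      have h₃ : (ψ r + s - ψ t) ^ 2 = (ψ r - ψ t) ^ 2 + s * (2 * (ψ r - ψ t) + s) := by ring
      constructor
      · nlinarith [mul_nonneg hs (show 0 ≤ 2 * (ψ r - ψ t) + s by linarith)]
      · intro hs'
        nlinarith [mul_pos hs' (show 0 < 2 * (ψ r - ψ t) + s by linarith)]
    · constructor
      · nlinarith [sq_nonneg s]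
      · intro hs'
        nlinarith [pow_pos hs' 2]
    · have : r ^ 2 < t ^ 2 := by nlinarith
      constructor
      · nlinarith [sq_nonneg (ψ r + s - ψ t)]
      · intro _
        nlinarith [sq_nonneg (ψ r + s - ψ t)]
  have hcenter : f 0 0 = r := by
    refine (pow_left_inj₀ (hf0 _ _) hr0.le two_ne_zero).1 (le_antisymm ?_ (hbase 0 le_rfl).1)
    refine (hup r hr 0 0).trans_eq ?_
    ring
  -- An upper bound for the sum of two distances in the strip, used to pass from squared distances
  -- to distances.
  set D : ℝ := 2 * (r + 1)
  have hD : 0 < D := by positivity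
  have hdec : ∀ s ∈ Ioo (0 : ℝ) 1, ∀ τ ∈ Icc 0 (ρ / 4), ∀ τ' ∈ Icc 0 (ρ / 4), τ ≤ τ' →
      f s τ' ≤ f s τ - ρ / D * (τ' - τ) := by
    intro s hs τ hτ τ' hτ' hle
    obtain ⟨t, ht, h₁⟩ := hlow s τ hτ.1
    have h₂ := hup t ht s τ'
    have htρ := hEρ t ht
    have h₃ : f s τ' ^ 2 ≤ f s τ ^ 2 - ρ * (τ' - τ) := by
      have h₄ : 0 ≤ (τ' - τ) * (2 * t - τ - τ' - ρ) :=
        mul_nonneg (by linarith) (by linarith [hτ.2, hτ'.2])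
      nlinarith
    have h₅ : f s τ' ≤ f s τ := by
      refine (abs_le_of_sq_le_sq' ?_ (hf0 s τ)).2
      have := mul_nonneg hρ.le (sub_nonneg.2 hle)
      linarith
    have h₆ : f s τ ≤ r + 1 := by
      refine (abs_le_of_sq_le_sq' ((hup r hr s τ).trans ?_) (by linarith)).2
      have hρr := hEρ r hr
      have h₇ : (τ - r) ^ 2 ≤ r ^ 2 := by nlinarith [hτ.1, hτ.2]
      have h₈ : (ψ r + s - ψ r) ^ 2 ≤ 1 := by
        rw [add_sub_cancel_left]; nlinarith [hs.1, hs.2]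
      nlinarith
    have h₇ : ρ * (τ' - τ) ≤ (f s τ - f s τ') * D := by
      nlinarith [mul_nonneg (sub_nonneg.2 h₅) (show 0 ≤ D - (f s τ + f s τ') by
        simp only [D]; linarith)]
    have h₈ : ρ / D * (τ' - τ) ≤ f s τ - f s τ' := by
      rwa [div_mul_eq_mul_div, div_le_iff₀ hD]
    linarith
  obtain ⟨δ, hδ, hδ1, hδr, hδρ⟩ : ∃ δ > 0, δ ≤ 1 ∧ δ ≤ r ∧ δ ≤ ρ / 4 := by
    exact ⟨min 1 (min r (ρ / 4)), by positivity, min_le_left _ _,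
      (min_le_right _ _).trans (min_le_left _ _), (min_le_right _ _).trans (min_le_right _ _)⟩
  -- At height `s² / r` the squared distance to `(ψ r, r)` is `r² - s² + s⁴ / r²`, which is below
  -- `r²` as `s < r`.
  have htop : ∀ s ∈ Ioo 0 δ, 0 < s ^ 2 / r ∧ s ^ 2 / r ≤ ρ / 4 ∧ f s (s ^ 2 / r) < r := by
    intro s hs
    have hs0 := hs.1
    have hsr : s < r := hs.2.trans_le hδr
    refine ⟨by positivity, ?_, ?_⟩
    · rw [div_le_iff₀ hr0]
      nlinarith [hs.2]
    · refine lt_of_pow_lt_pow_left₀ 2 hr0.le ((hup r hr s _).trans_lt ?_)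
      have h₁ : s ^ 2 / r * r = s ^ 2 := div_mul_cancel₀ _ hr0.ne'
      have h₂ : s ^ 2 / r < s := by rw [div_lt_iff₀ hr0]; nlinarith
      have h₃ : 0 < s ^ 2 / r := by positivity
      nlinarith
  have hroot : ∀ s, ∃ τ, s ∈ Ioo 0 δ → 0 < τ ∧ τ ≤ s ^ 2 / r ∧ f s τ = r := by
    intro s
    by_cases hs : s ∈ Ioo 0 δ
    swap
    · exact ⟨0, fun h => absurd h hs⟩
    obtain ⟨h₁, h₂, h₃⟩ := htop s hs
    have h₄ : r < f s 0 := lt_of_pow_lt_pow_left₀ 2 (hf0 _ _) ((hbase s hs.1.le).2 hs.1)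
    have hc : Continuous (f s) := by
      refine (continuous_distFun F).comp ((PiLp.continuous_toLp 2 _).comp
        (continuous_pi fun i => ?_))
      fin_cases i
      · exact continuous_const
      · exact continuous_id
    obtain ⟨τ, hτ, hτr⟩ := intermediate_value_Icc' h₁.le hc.continuousOn ⟨h₃.le, h₄.le⟩
    refine ⟨τ, fun _ => ⟨lt_of_le_of_ne hτ.1 ?_, hτ.2, hτr⟩⟩
    rintro rfl
    linarith
  choose y hy using hroot
  have ha : distFun F !₂[ψ r, 0] = r := by simpa only [f, add_zero] using hcenter
  refine ⟨ha, δ, 1 / r, y, hδ, ?_, ?_⟩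
  · have hL : LipschitzOnWith (D / ρ).toNNReal y (Ioo 0 δ) := by
      refine LipschitzOnWith.of_dist_le_mul fun s hs s' hs' => ?_
      rw [Real.coe_toNNReal _ (by positivity), Real.dist_eq, Real.dist_eq]
      obtain ⟨a₁, a₂, a₃⟩ := hy s hs
      obtain ⟨b₁, b₂, b₃⟩ := hy s' hs'
      have := abs_sub_le_of_level (f := f) (c := ρ / D) (L := 1) (T := Icc 0 (ρ / 4)) (s := s)
        (s' := s') (τ := y s) (τ' := y s') ?_ (hdec s ⟨hs.1, hs.2.trans_le hδ1⟩)
        ⟨a₁.le, a₂.trans (htop s hs).2.1⟩ ⟨b₁.le, b₂.trans (htop s' hs').2.1⟩ (a₃.trans b₃.symm)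
      · rw [one_mul, div_mul_eq_mul_div, div_le_iff₀ hD] at this
        rw [div_mul_eq_mul_div, le_div_iff₀ hρ]
        linarith
      · intro τ _
        have h₁ := (Metric.lipschitz_infDist_pt F).dist_le_mul !₂[ψ r + s, τ] !₂[ψ r + s', τ]
        have h₂ : dist (!₂[ψ r + s, τ] : Plane) !₂[ψ r + s', τ] ≤ |s - s'| := by
          refine (abs_le_of_sq_le_sq' ?_ (abs_nonneg _)).2
          rw [dist_sq_plane, sq_abs]
          apply le_of_eq; simp
        rw [NNReal.coe_one, one_mul, Real.dist_eq] at h₁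
        rw [one_mul]
        exact h₁.trans h₂
    exact hL.continuousOn
  · intro s hs
    obtain ⟨h₁, h₂, h₃⟩ := hy s hs
    have e : ∀ q : ℝ, (!₂[ψ r, 0] + !₂[s, q] : Plane) = !₂[ψ r + s, q] := fun q =>
      plane_ext (by simp) (by simp)
    refine ⟨h₁, by rwa [one_div_mul_eq_div], ?_, ?_⟩
    · rw [e]; exact h₃
    · rw [e]
      exact (distFun_mirrorGraph_neg hψ hE hne _ _).trans h₃

end MirrorGraph

theorem IsBT.exists_compact_hasCusp {K : Set ℝ} (hK : IsBT (1 / 2) K) {ρ R : ℝ} (hρ : 0 < ρ)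
    (hR : 0 < R) : ∃ (F : Set Plane) (M : ℝ), IsCompact F ∧ F.Nonempty ∧
      ∀ r ∈ K ∩ Icc ρ R, ∃ a, ‖a‖ ≤ M ∧ HasCusp (distSphere F r) a := by
  rcases (K ∩ Icc ρ R).eq_empty_or_nonempty with hE | hne
  · exact ⟨{0}, 0, isCompact_singleton, singleton_nonempty 0, by simp [hE]⟩
  obtain ⟨φ, hφ, hφK⟩ := hK.exists_stretch
  have hE : IsCompact (K ∩ Icc ρ R) := hK.1.inter_right isClosed_Icc
  -- The factor `√(2 * R)` turns the bound on `r' - r` into one on `r'² - r² ≤ 2R (r' - r)`.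
  set ψ : ℝ → ℝ := fun r => √(2 * R) * φ r
  have hψ : Continuous ψ := by fun_prop
  have hcomp : IsCompact (mirrorGraph ψ (K ∩ Icc ρ R)) := isCompact_mirrorGraph hψ hE
  obtain ⟨M, hM⟩ := hE.exists_bound_of_continuousOn hψ.continuousOn
  refine ⟨mirrorGraph ψ (K ∩ Icc ρ R), M, hcomp, (hne.image _).inl, fun r hr => ⟨_, ?_,
    hasCusp_mirrorGraph hψ hE hρ (fun r hr => hr.2.1) ?_ hr⟩⟩
  · have h₁ := hM r hr
    refine (abs_le_of_sq_le_sq' ?_ ((norm_nonneg _).trans h₁)).2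
    rw [norm_sq_plane]
    rw [Real.norm_eq_abs] at h₁
    have := sq_le_sq' (by linarith [abs_le.1 h₁]) (abs_le.1 h₁).2
    simpa using this
  · intro r hr r' hr' hlt
    have h₁ := hφK r hr.1 r' hr'.1 hlt
    have h₂ : 0 < √(r' - r) := Real.sqrt_pos.2 (by linarith)
    have h₃ : 0 < √(2 * R) := Real.sqrt_pos.2 (by linarith)
    have h₄ : ψ r' - ψ r = √(2 * R) * (φ r' - φ r) := by simp only [ψ]; ring
    constructor
    · have := mul_pos h₃ (h₂.trans_le h₁)
      linarith
    · rw [h₄, mul_pow, Real.sq_sqrt (by linarith)]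
      have h₅ : r' - r ≤ (φ r' - φ r) ^ 2 := by
        rw [← Real.sq_sqrt (show 0 ≤ r' - r by linarith)]
        exact pow_le_pow_left₀ h₂.le h₁ 2
      have h₆ : r' ^ 2 - r ^ 2 ≤ 2 * R * (r' - r) := by nlinarith [hr.2.2, hr'.2.2]
      nlinarith

/-! ### Gluing countably many compact sets -/

theorem HasCusp.translate {S S' : Set Plane} {a v : Plane} {ε : ℝ} (h : HasCusp S a) (hε : 0 < ε)
    (hS : ∀ z ∈ S, dist z a < ε → z + v ∈ S') : HasCusp S' (a + v) := by
  obtain ⟨ha, δ, C, y, hδ, hyc, hy⟩ := h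
  have hC : 0 < C := by
    obtain ⟨h₁, h₂, -⟩ := hy (δ / 2) ⟨by linarith, by linarith⟩
    by_contra! hC
    nlinarith [sq_nonneg (δ / 2)]
  obtain ⟨d, hd, hdδ, hdε, hdC⟩ : ∃ d > 0, d ≤ δ ∧ 2 * d < ε ∧ C * d ≤ 1 := by
    refine ⟨min δ (min (ε / 4) (1 / C)), by positivity, min_le_left _ _, ?_, ?_⟩
    · have := (min_le_right δ _).trans (min_le_left (ε / 4) (1 / C))
      linarith
    · have := (min_le_right δ _).trans (min_le_right (ε / 4) (1 / C))
      rwa [le_div_iff₀ hC, mul_comm] at this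
  have hsub : Ioo 0 d ⊆ Ioo 0 δ := Ioo_subset_Ioo le_rfl hdδ
  refine ⟨hS a ha (by simpa using hε), d, C, y, hd, hyc.mono hsub, fun x hx => ?_⟩
  obtain ⟨h₁, h₂, h₃, h₄⟩ := hy x (hsub hx)
  have h₅ : y x ≤ x := by
    have : C * x ≤ C * d := mul_le_mul_of_nonneg_left hx.2.le hC.le
    nlinarith [hx.1]
  have hdist : ∀ q, q ^ 2 = y x ^ 2 → dist (a + !₂[x, q]) a < ε := by
    intro q hq
    refine lt_of_le_of_lt (abs_le_of_sq_le_sq' (b := 2 * x) ?_ (by linarith [hx.1])).2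
      (by linarith [hx.2])
    rw [dist_sq_plane]
    simp only [PiLp.add_apply, Matrix.cons_val_zero, Matrix.cons_val_one,
      add_sub_cancel_left]
    nlinarith [hx.1]
  refine ⟨h₁, h₂, ?_, ?_⟩
  · rw [add_right_comm]; exact hS _ h₃ (hdist _ rfl)
  · rw [add_right_comm]; exact hS _ h₄ (hdist _ (neg_sq _))

/-- Countably many compact sets can be placed so far apart that near each of them the distance
function of their union is that of the set itself. -/
theorem exists_closed_glue {F : ℕ → Set Plane} (hF : ∀ i, IsCompact (F i))
    (hne : ∀ i, (F i).Nonempty) (M : ℕ → ℝ) :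
    ∃ (G : Set Plane) (v : ℕ → Plane), IsClosed G ∧ G.Nonempty ∧
      ∀ i x, ‖x‖ ≤ M i → distFun G (x + v i) = distFun (F i) x := by
  have hB : ∀ i, ∃ B, 1 ≤ B ∧ M i ≤ B ∧ ∀ y ∈ F i, ‖y‖ ≤ B := by
    intro i
    obtain ⟨b, hb⟩ := (hF i).isBounded.exists_norm_le
    exact ⟨max 1 (max (M i) b), le_max_left _ _, (le_max_left _ _).trans (le_max_right _ _),
      fun y hy => (hb y hy).trans ((le_max_right _ _).trans (le_max_right _ _))⟩
  choose B hB1 hBM hBF using hB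
  -- The spacing exceeds the radii so much that, seen from within the `i`-th ball, every other piece
  -- is farther away than the `i`-th.
  set c : ℕ → ℝ := fun i => ∑ k ∈ Finset.range i, 6 * (B k + B (k + 1))
  have hterm : ∀ k, 0 ≤ 6 * (B k + B (k + 1)) := fun k => by linarith [hB1 k, hB1 (k + 1)]
  have hmono : Monotone c := monotone_nat_of_le_succ fun k => by
    simp only [c, Finset.sum_range_succ]; linarith [hterm k]
  have hgrow : ∀ i j, i < j → 3 * (B i + B j) ≤ c j - c i := by
    intro i j hij
    obtain ⟨k, rfl⟩ : ∃ k, j = k + 1 := ⟨j - 1, by omega⟩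
    have h₁ : c (k + 1) = c k + 6 * (B k + B (k + 1)) := Finset.sum_range_succ _ _
    have h₂ : c (i + 1) = c i + 6 * (B i + B (i + 1)) := Finset.sum_range_succ _ _
    have h₃ : c i ≤ c k := hmono (by omega)
    have h₄ : c (i + 1) ≤ c (k + 1) := hmono (by omega)
    linarith [hB1 i, hB1 k, hB1 (k + 1), hB1 (i + 1)]
  set v : ℕ → Plane := fun i => !₂[c i, 0]
  have hv : ∀ i j, i ≠ j → 3 * (B i + B j) ≤ dist (v i) (v j) := by
    intro i j hij
    have h₁ : dist (v i) (v j) = |c i - c j| := by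
      refine (pow_left_inj₀ dist_nonneg (abs_nonneg _) two_ne_zero).1 ?_
      rw [dist_sq_plane, sq_abs]; simp [v]
    rw [h₁]
    rcases lt_or_gt_of_ne hij with h | h
    · rw [abs_sub_comm]
      exact (hgrow i j h).trans (le_abs_self _)
    · have := hgrow j i h
      linarith [le_abs_self (c i - c j)]
  set T : ℕ → Set Plane := fun i => (fun x => x + v i) '' F i
  have hT : ∀ i, ∀ z ∈ T i, dist z (v i) ≤ B i := by
    rintro i _ ⟨y, hy, rfl⟩
    simpa [dist_eq_norm] using hBF i y hy
  refine ⟨⋃ i, T i, v, ?_, ?_, ?_⟩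
  · refine LocallyFinite.isClosed_iUnion (fun x => ?_)
      fun i => ((hF i).image (continuous_add_const (v i))).isClosed
    refine ⟨Metric.ball x 1, Metric.ball_mem_nhds x one_pos, Set.Subsingleton.finite ?_⟩
    rintro i ⟨z, hz, hzx⟩ j ⟨z', hz', hzx'⟩
    by_contra hij
    have h₁ := hv i j hij
    have h₂ := hT i z hz
    have h₃ := hT j z' hz'
    rw [Metric.mem_ball] at hzx hzx'
    have h₄ := dist_triangle4 (v i) z z' (v j)
    have h₅ := dist_triangle_right z z' x
    rw [dist_comm (v i) z] at h₄
    linarith [hB1 i, hB1 j]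
  · obtain ⟨y, hy⟩ := hne 0
    exact ⟨y + v 0, mem_iUnion.2 ⟨0, y, hy, rfl⟩⟩
  · intro i x hx
    obtain ⟨y₀, hy₀, hxy₀⟩ := exists_distFun_eq (hF i).isClosed (hne i) x
    have hmem : y₀ + v i ∈ ⋃ i, T i := mem_iUnion.2 ⟨i, y₀, hy₀, rfl⟩
    apply le_antisymm
    · have := distFun_le hmem (x + v i)
      rwa [dist_add_right, hxy₀] at this
    · refine (Metric.le_infDist ⟨_, hmem⟩).2 fun z hz => ?_
      obtain ⟨j, y, hy, rfl⟩ := mem_iUnion.1 hz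
      rcases eq_or_ne i j with rfl | hij
      · rw [dist_add_right]
        exact distFun_le hy x
      · have h₁ := hv i j hij
        have h₂ := hBF j y hy
        have h₃ := hBF i y₀ hy₀
        have h₄ : distFun (F i) x ≤ 2 * B i := by
          rw [← hxy₀, dist_eq_norm]
          exact (norm_sub_le _ _).trans (by linarith [hBM i])
        have h₅ := dist_triangle4 (v i) (x + v i) (y + v j) (v j)
        have h₆ : dist (v i) (x + v i) = ‖x‖ := by simp [dist_eq_norm]
        have h₇ : dist (y + v j) (v j) = ‖y‖ := by simp [dist_eq_norm]
        linarith [hBM i, hB1 i, hB1 j]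

/-- Each piece `K n` is cut down to the intervals `[1/(m+1), m+1]`, where the cusp construction
applies; the pairs `(n, m)` are enumerated by one index. -/
theorem exists_subset_lipExceptional {A : Set ℝ} (hA : A ⊆ Ioi 0) {K : ℕ → Set ℝ}
    (hK : ∀ n, IsBT (1 / 2) (K n)) (hAK : A ⊆ ⋃ n, K n) :
    ∃ F : Set Plane, IsClosed F ∧ F.Nonempty ∧ A ⊆ lipExceptional F := by
  have h := fun j : ℕ => (hK j.unpair.1).exists_compact_hasCusp
    (ρ := 1 / ((j.unpair.2 : ℝ) + 1)) (R := (j.unpair.2 : ℝ) + 1) (by positivity) (by positivity)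
  choose F M hF hne hcusp using h
  -- The margin `1` lets the distance functions agree on a unit disc around each cusp.
  obtain ⟨G, v, hG, hGne, hglue⟩ := exists_closed_glue hF hne (fun i => M i + 1)
  refine ⟨G, hG, hGne, fun r hr => ?_⟩
  have hr0 : 0 < r := hA hr
  obtain ⟨n, hn⟩ := mem_iUnion.1 (hAK hr)
  obtain ⟨m₁, hm₁⟩ := exists_nat_one_div_lt hr0
  obtain ⟨m₂, hm₂⟩ := exists_nat_ge r
  set m := max m₁ m₂
  have e₁ : (m₁ : ℝ) ≤ m := by exact_mod_cast le_max_left m₁ m₂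
  have e₂ : (m₂ : ℝ) ≤ m := by exact_mod_cast le_max_right m₁ m₂
  obtain ⟨a, haM, ha⟩ := hcusp (Nat.pair n m) r (by
    rw [Nat.unpair_pair]
    refine ⟨hn, (one_div_le_one_div_of_le (by positivity) ?_).trans hm₁.le, ?_⟩
    · simpa using e₁
    · simp only; linarith)
  have hcuspG : HasCusp (distSphere G r) (a + v (Nat.pair n m)) := by
    refine ha.translate one_pos fun z hz hza => ?_
    refine (hglue _ z ?_).trans hz
    have := norm_le_norm_add_norm_sub' z a
    rw [← dist_eq_norm] at this
    linarith
  exact ⟨hr0, ⟨_, hcuspG.1⟩, hcuspG.not_isLipManifold⟩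

end DistCrit

theorem mainTheorem6 :
    (∀ A : Set ℝ, A ⊆ Set.Ioi 0 →
      List.TFAE [
        ∃ F : Set DistCrit.Plane, IsClosed F ∧ F.Nonempty ∧ A ⊆ DistCrit.lipExceptional F,
        ∃ F : Set DistCrit.Plane, IsClosed F ∧ F.Nonempty ∧
          A ⊆ DistCrit.critValues (DistCrit.distFun F),
        ∃ K : ℕ → Set ℝ, (∀ n, DistCrit.IsBT (1 / 2) (K n)) ∧ A ⊆ ⋃ n, K n]) ∧
    (∀ F : Set DistCrit.Plane, IsClosed F → F.Nonempty →
      DistCrit.IsCountableUnionZeroContent (1 / 2) (DistCrit.critValues (DistCrit.distFun F)) ∧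
      DistCrit.IsCountableUnionZeroContent (1 / 2) (DistCrit.lipExceptional F) ∧
      DistCrit.IsCountableUnionZeroContent (1 / 2) (DistCrit.topExceptional F) ∧
      DistCrit.packingDim (DistCrit.critValues (DistCrit.distFun F)) ≤ 1 / 2) := by
  refine ⟨fun A hA => ?_, fun F hF hne => ?_⟩
  · tfae_have 1 → 2 := fun ⟨F, hF, hne, h⟩ =>
      ⟨F, hF, hne, h.trans (DistCrit.lipExceptional_subset_critValues F)⟩
    tfae_have 2 → 3 := fun ⟨F, hF, hne, h⟩ =>
      let ⟨K, hK, hcov⟩ := DistCrit.critValues_subset_iUnion hF hne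
      ⟨K, hK, h.trans hcov⟩
    tfae_have 3 → 1 := fun ⟨K, hK, hcov⟩ => DistCrit.exists_subset_lipExceptional hA hK hcov
    tfae_finish
  · obtain ⟨K, hK, hcov⟩ := DistCrit.critValues_subset_iUnion hF hne
    have hlip := (DistCrit.lipExceptional_subset_critValues F).trans hcov
    have htop := (DistCrit.topExceptional_subset_lipExceptional F).trans hlip
    exact ⟨DistCrit.isCountableUnionZeroContent_of_subset hK hcov,
      DistCrit.isCountableUnionZeroContent_of_subset hK hlip,
      DistCrit.isCountableUnionZeroContent_of_subset hK htop,
      DistCrit.packingDim_le_of_subset hK hcov⟩
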